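/- Let $\Omega\subset\mathbb R^2$ be a bounded open set with Lipschitz boundary. For $u\in L^2(\Omega)$ let $$J_{TV}(u)=\sup\Big\{\int_\Omega u\,\operatorname{div}\varphi\,dx:\ \varphi\in C_c^\infty(\Omega;\mathbb R^2),\ |\varphi(x)|\le 1\ \text{for all }x\Big\}\in[0,+\infty],$$ and let $\partial J_{TV}(u)=\{p\in L^2(\Omega): J_{TV}(v)\ge J_{TV}(u)+\langle p,v-u\rangle\ \ \forall v\in L^2(\Omega)\}$ be its subdifferential. A solution of the TV flow with Neumann boundary conditions and initial datum $u_0\in L^2(\Omega)$ is a function $u\in C([0,\infty);L^2(\Omega))$ with $u(0)=u_0$ that is absolutely continuous on every compact subinterval of $(0,\infty)$ and such that for almost every $t>0$ it is differentiable at $t$ and $u_t(t)=-p(t)$ with $p(t)\in\partial J_{TV}(u(t))$, where the homogeneous Neumann condition holds in the weak sense: there is a measurable $z:\Omega\to\mathbb R^2$ with $|z|\le 1$ a.e. and $\int_\Omega z\cdot\nabla w\,dx=\int_\Omega p(t)\,w\,dx$ for all $w\in C_c^\infty(\mathbb R^2)$ (that is, $p(t)=-\operatorname{div}z$ in $\Omega$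 and $z\cdot n=0$ on $\partial\Omega$). Then for every $u_0\in L^2(\Omega)$ there is exactly one solution $u$ on $[0,\infty)$, and the solution operator $\psi:L^2(\Omega)\times(0,\infty)\to L^2(\Omega)$, $\psi(u_0,t):=u(t)$, is locally Lipschitz jointly in $(u_0,t)$ with respect to the norm $\|u_0\|_{L^2(\Omega)}+|t|$. More precisely, for all $u_0\in L^2(\Omega)$, $t>0$ and $0<\varepsilon<t$, $$\|\psi(v,\tau)-\psi(w,\sigma)\|\le\max\Big\{\frac{\|u_0\|+\varepsilon}{t-\varepsilon},\,1\Big\}\big(\|v-w\|+|\tau-\sigma|\big)$$ whenever $\|v-u_0\|<\varepsilon$, $\|w-u_0\|<\varepsilon$, $|\tau-t|<\varepsilon$, $|\sigma-t|<\varepsilon$. -/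

import Mathlib

open MeasureTheory Set TopologicalSpace
open scoped Distributions NNReal

noncomputable section

namespace TVFlow

/-- The Euclidean plane `ℝ²`. -/
abbrev Plane : Type := EuclideanSpace ℝ (Fin 2)

/-- `Ω` has Lipschitz boundary: near each boundary point, after a rigid motion `e` of the plane,
`Ω` is the strict epigraph of a Lipschitz function of one variable. -/
def HasLipschitzBoundary (Ω : Set Plane) : Prop :=
  ∀ x ∈ frontier Ω, ∃ r : ℝ, 0 < r ∧ ∃ e : Plane ≃ᵢ Plane, ∃ K : ℝ≥0, ∃ γ : ℝ → ℝ,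
    LipschitzWith K γ ∧ ∀ y ∈ Metric.ball x r, (y ∈ Ω ↔ γ (e y 0) < e y 1)

/-- The real Hilbert space `L²(Ω)` with respect to Lebesgue measure on `Ω`. -/
abbrev L2 (Ω : Opens Plane) : Type := Lp ℝ 2 (volume.restrict (Ω : Set Plane))

/-- The divergence `∂₁φ₁ + ∂₂φ₂` of a vector field on the plane. -/
def divergence (φ : Plane → Plane) (x : Plane) : ℝ :=
  ∑ i : Fin 2, fderiv ℝ φ x (EuclideanSpace.single i 1) i

/-- The total variation `J_TV(u) = sup ∫_Ω u div φ`, the supremum being over all smooth vector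
fields `φ` with compact support in `Ω` and `|φ(x)| ≤ 1` for every `x`. -/
def totalVariation (Ω : Opens Plane) (u : L2 Ω) : EReal :=
  ⨆ φ : {φ : 𝓓(Ω, Plane) // ∀ x, ‖φ x‖ ≤ 1},
    ((∫ x in (Ω : Set Plane), u x * divergence φ.1 x : ℝ) : EReal)

/-- The subdifferential of a functional `J : H → ℝ ∪ {+∞}` at `u`. -/
def subdifferential {H : Type*} [NormedAddCommGroup H] [InnerProductSpace ℝ H]
    (J : H → EReal) (u : H) : Set H :=
  {p | ∀ v, J u + ((inner ℝ p (v - u) : ℝ) : EReal) ≤ J v}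

/-- The homogeneous Neumann condition in weak form: `p = -div z` in `Ω` for a diffusion flux `z`
with `|z| ≤ 1` (playing the role of `∇u / |∇u|`) whose normal trace `z · n` on `∂Ω` vanishes. Since
the test functions `w` need not vanish on `∂Ω`, the integral identity encodes both the equation
`p = -div z` and the boundary condition `z · n = 0`. -/
def HasNeumannFlux (Ω : Opens Plane) (p : L2 Ω) : Prop :=
  ∃ z : Plane → Plane, AEStronglyMeasurable z (volume.restrict (Ω : Set Plane)) ∧
    (∀ᵐ x ∂(volume.restrict (Ω : Set Plane)), ‖z x‖ ≤ 1) ∧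
    ∀ w : 𝓓((⊤ : Opens Plane), ℝ),
      ∫ x in (Ω : Set Plane), inner ℝ (z x) (gradient w x) = ∫ x in (Ω : Set Plane), p x * w x

/-- `u : [0, ∞) → L²(Ω)` is a (strong) solution of the total variation flow with Neumann boundary
conditions and initial datum `u₀` (values of `u` at negative times play no role). -/
structure IsTVFlow (Ω : Opens Plane) (u₀ : L2 Ω) (u : ℝ → L2 Ω) : Prop where
  continuousOn : ContinuousOn u (Ici 0)
  initial : u 0 = u₀
  absolutelyContinuous : ∀ a b : ℝ, 0 < a → a ≤ b → AbsolutelyContinuousOnInterval u a b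
  flow : ∀ᵐ t ∂(volume.restrict (Ioi (0 : ℝ))),
    ∃ p ∈ subdifferential (totalVariation Ω) (u t), HasNeumannFlux Ω p ∧ HasDerivAt u (-p) t

end TVFlow

end

/-! `totalVariation` is the support function of the closed convex set K = `tvPolar Ω`, the L²
closure of the divergences of admissible fields. A point of K maximising the pairing with u is a
subgradient at u, so the flow can be built in an abstract Hilbert space from any closed convex K
containing 0.

Existence: the implicit Euler step subtracts a projection onto K and is nonexpansive. The
Crandall–Liggett estimate makes the Euler schemes converge on the dense set of points with nonempty
face, hence everywhere. The discrete energy inequality `euler_energy_le` survives in the limit and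
yields the smoothing bound: at time t the speed is at most ‖u₀‖ / t. Weak limits of difference
quotients are subgradients, and comparison with the subgradient of minimal norm upgrades weak to
strong convergence off a countable set of times. Every element of K has a Neumann flux, a weak limit
of the fields -φ.

Uniqueness and contraction in the initial datum follow from monotonicity of the subdifferential.
Contraction and the smoothing bound together give the Lipschitz constant. -/

namespace TVFlow

/-! ### Implicit Euler steps and the Crandall–Liggett estimate -/

section ConvexFlow

open Filter Topology

variable {H : Type*} [NormedAddCommGroup H] [InnerProductSpace ℝ H] {K : Set H}

/-- The points of `K` at which the linear functional `⟪·, x⟫` attains its maximum over `K`. This is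
the subdifferential at `x` of the support function of `K`. -/
def supportFace (K : Set H) (x : H) : Set H :=
  {p | p ∈ K ∧ ∀ k ∈ K, inner ℝ k x ≤ inner ℝ p x}

theorem supportFace_monotone {x y p q : H} (hp : p ∈ supportFace K x) (hq : q ∈ supportFace K y) :
    0 ≤ inner ℝ (p - q) (x - y) := by
  have h1 := hp.2 q hq.1
  have h2 := hq.2 p hp.1
  simp only [inner_sub_left, inner_sub_right]
  linarith

theorem isClosed_supportFace (hK : IsClosed K) (x : H) : IsClosed (supportFace K x) := by
  have : supportFace K x = K ∩ ⋂ k ∈ K, {p | inner ℝ k x ≤ inner ℝ p x} := by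
    ext p; simp [supportFace]
  rw [this]
  refine hK.inter (isClosed_biInter fun k _ => ?_)
  exact isClosed_le continuous_const (continuous_id.inner continuous_const)

theorem convex_supportFace (hc : Convex ℝ K) (x : H) : Convex ℝ (supportFace K x) := by
  intro p hp q hq a b ha hb hab
  refine ⟨hc hp.1 hq.1 ha hb hab, fun k hk => ?_⟩
  rw [inner_add_left, real_inner_smul_left, real_inner_smul_left]
  have h1 := mul_le_mul_of_nonneg_left (hp.2 k hk) ha
  have h2 := mul_le_mul_of_nonneg_left (hq.2 k hk) hb
  calc inner ℝ k x = a * inner ℝ k x + b * inner ℝ k x := by rw [← add_mul, hab, one_mul]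
    _ ≤ _ := add_le_add h1 h2

/-- Moreau decomposition: p is the projection of x / h onto K, whose variational inequality is
exactly maximality of p at x - h p. -/
theorem exists_mem_supportFace_sub_smul [CompleteSpace H] (hK : IsClosed K) (hc : Convex ℝ K)
    (hne : K.Nonempty) {h : ℝ} (hh : 0 < h) (x : H) : ∃ p, p ∈ supportFace K (x - h • p) := by
  obtain ⟨p, hp, hmin⟩ := exists_norm_eq_iInf_of_complete_convex hne hK.isComplete hc (h⁻¹ • x)
  rw [norm_eq_iInf_iff_real_inner_le_zero hc hp] at hmin
  refine ⟨p, hp, fun k hk => ?_⟩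
  have h1 := hmin k hk
  have h2 : x - h • p = h • (h⁻¹ • x - p) := by
    rw [smul_sub, smul_inv_smul₀ hh.ne']
  rw [h2, real_inner_smul_right, real_inner_smul_right]
  rw [real_inner_comm, inner_sub_left] at h1
  exact mul_le_mul_of_nonneg_left (by linarith) hh.le

/-- The cross term in the expanded square is nonnegative by monotonicity. This gives both
nonexpansiveness and uniqueness of the implicit step. -/
theorem norm_sub_le_of_mem_supportFace {h : ℝ} (hh : 0 ≤ h) {y z p q : H}
    (hp : p ∈ supportFace K y) (hq : q ∈ supportFace K z) :
    ‖y - z‖ ≤ ‖(y + h • p) - (z + h • q)‖ := by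
  have h1 := supportFace_monotone hp hq
  have h2 : (y + h • p) - (z + h • q) = (y - z) + h • (p - q) := by module
  rw [h2]
  refine le_of_sq_le_sq ?_ (norm_nonneg _)
  rw [norm_add_sq_real, real_inner_smul_right, real_inner_comm]
  nlinarith [mul_nonneg hh h1, sq_nonneg ‖h • (p - q)‖]

open Classical in
/-- The velocity of one implicit Euler step of size `h` from `x`. -/
noncomputable def eulerSlope (K : Set H) (h : ℝ) (x : H) : H :=
  -- The default 0 is never taken when K is a flow generator and h > 0.
  if hx : ∃ p, p ∈ supportFace K (x - h • p) then hx.choose else 0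

/-- One implicit Euler step of size `h` for the inclusion `-u' ∈ supportFace K u`. -/
noncomputable def eulerStep (K : Set H) (h : ℝ) (x : H) : H := x - h • eulerSlope K h x

theorem eulerStep_add_smul (h : ℝ) (x : H) : eulerStep K h x + h • eulerSlope K h x = x := by
  simp [eulerStep]

section Closed

variable [CompleteSpace H]

/-- The hypotheses on the set `K` under which its support function generates a flow. -/
structure IsFlowGenerator (K : Set H) : Prop where
  isClosed : IsClosed K
  convex : Convex ℝ K
  zero_mem : (0 : H) ∈ K

variable (hK : IsFlowGenerator K)
include hK

theorem IsFlowGenerator.eulerSlope_mem {h : ℝ} (hh : 0 < h) (x : H) :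
    eulerSlope K h x ∈ supportFace K (eulerStep K h x) := by
  have hx := exists_mem_supportFace_sub_smul hK.isClosed hK.convex ⟨0, hK.zero_mem⟩ hh x
  rw [eulerStep, eulerSlope, dif_pos hx]
  exact hx.choose_spec

theorem IsFlowGenerator.norm_eulerStep_sub_le {h : ℝ} (hh : 0 < h) (x y : H) :
    ‖eulerStep K h x - eulerStep K h y‖ ≤ ‖x - y‖ := by
  simpa only [eulerStep_add_smul] using
    norm_sub_le_of_mem_supportFace hh.le (hK.eulerSlope_mem hh x) (hK.eulerSlope_mem hh y)

theorem IsFlowGenerator.eulerStep_eq {h : ℝ} (hh : 0 < h) {y p : H} (hp : p ∈ supportFace K y) :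
    eulerStep K h (y + h • p) = y := by
  have := norm_sub_le_of_mem_supportFace hh.le (hK.eulerSlope_mem hh (y + h • p)) hp
  rw [eulerStep_add_smul, sub_self, norm_zero] at this
  exact sub_eq_zero.1 (norm_eq_zero.1 (le_antisymm this (norm_nonneg _)))

/-- Resolvent identity: the slope found at the end point of the l-step also serves for a μ-step
ending at the same point. -/
theorem IsFlowGenerator.eulerStep_resolvent {μ l : ℝ} (hμ : 0 < μ) (hl : μ ≤ l) (x : H) :
    eulerStep K μ ((μ / l) • x + (1 - μ / l) • eulerStep K l x) = eulerStep K l x := by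
  have hl0 : 0 < l := hμ.trans_le hl
  have h1 : (μ / l) • x + (1 - μ / l) • eulerStep K l x
      = eulerStep K l x + μ • eulerSlope K l x := by
    have : μ • eulerSlope K l x = (μ / l) • (l • eulerSlope K l x) := by
      rw [smul_smul, div_mul_cancel₀ _ hl0.ne']
    rw [this, eulerStep]
    module
  rw [h1]
  exact hK.eulerStep_eq hμ (hK.eulerSlope_mem hl0 x)

theorem IsFlowGenerator.norm_iterate_eulerStep_sub_le {h : ℝ} (hh : 0 < h) (n : ℕ) (x y : H) :
    ‖(eulerStep K h)^[n] x - (eulerStep K h)^[n] y‖ ≤ ‖x - y‖ := by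
  induction n with
  | zero => simp
  | succ n ih =>
    rw [Function.iterate_succ_apply', Function.iterate_succ_apply']
    exact (hK.norm_eulerStep_sub_le hh _ _).trans ih

theorem IsFlowGenerator.norm_eulerStep_sub_self_le {h : ℝ} (hh : 0 < h) {x p : H}
    (hp : p ∈ supportFace K x) : ‖eulerStep K h x - x‖ ≤ h * ‖p‖ := by
  have := hK.norm_eulerStep_sub_le hh x (x + h • p)
  rw [hK.eulerStep_eq hh hp] at this
  simpa [norm_smul, abs_of_pos hh] using this

theorem IsFlowGenerator.norm_iterate_eulerStep_sub_self_le {h : ℝ} (hh : 0 < h) {x p : H}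
    (hp : p ∈ supportFace K x) (n : ℕ) : ‖(eulerStep K h)^[n] x - x‖ ≤ n * (h * ‖p‖) := by
  induction n with
  | zero => simp
  | succ n ih =>
    rw [Function.iterate_succ_apply]
    have h1 := hK.norm_iterate_eulerStep_sub_le hh n (eulerStep K h x) x
    have h2 := hK.norm_eulerStep_sub_self_le hh hp
    have h3 := norm_sub_le_norm_sub_add_norm_sub
      ((eulerStep K h)^[n] (eulerStep K h x)) ((eulerStep K h)^[n] x) x
    push_cast
    linarith

theorem IsFlowGenerator.norm_iterate_add_sub_iterate_le {h : ℝ} (hh : 0 < h) {x p : H}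
    (hp : p ∈ supportFace K x) (n m : ℕ) :
    ‖(eulerStep K h)^[n + m] x - (eulerStep K h)^[n] x‖ ≤ m * (h * ‖p‖) := by
  rw [Function.iterate_add_apply]
  exact (hK.norm_iterate_eulerStep_sub_le hh n _ _).trans
    (hK.norm_iterate_eulerStep_sub_self_le hh hp m)

/-- The Crandall–Liggett estimate comparing implicit Euler schemes with step sizes `μ ≤ l`. -/
theorem IsFlowGenerator.norm_iterate_sub_iterate_sq_le {μ l : ℝ} (hμ : 0 < μ) (hl : μ ≤ l)
    {x p : H} (hp : p ∈ supportFace K x) (n m : ℕ) :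
    ‖(eulerStep K l)^[m] x - (eulerStep K μ)^[n] x‖ ^ 2
      ≤ ‖p‖ ^ 2 * ((m * l - n * μ) ^ 2 + n * μ * (l - μ)) := by
  have hl0 : 0 < l := hμ.trans_le hl
  induction n generalizing m with
  | zero =>
    have := hK.norm_iterate_eulerStep_sub_self_le hl0 hp m
    simp only [Function.iterate_zero, id, Nat.cast_zero, zero_mul, sub_zero, add_zero]
    calc _ ≤ (m * (l * ‖p‖)) ^ 2 := by gcongr
      _ = _ := by ring
  | succ n ih =>
    rcases m with _ | m
    · have := hK.norm_iterate_eulerStep_sub_self_le hμ hp (n + 1)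
      rw [norm_sub_rev] at this
      simp only [Function.iterate_zero, id] at this ⊢
      have h0 : 0 ≤ ‖p‖ ^ 2 * (((n + 1 : ℕ) : ℝ) * μ * (l - μ)) := by
        have := sub_nonneg.2 hl
        positivity
      calc _ ≤ (((n + 1 : ℕ) : ℝ) * (μ * ‖p‖)) ^ 2 := by gcongr
        _ ≤ _ := by push_cast at h0 ⊢; nlinarith
    · set a := μ / l with ha
      have ha0 : 0 ≤ a := by positivity
      have ha1 : a ≤ 1 := (div_le_one hl0).2 hl
      have hal : a * l = μ := div_mul_cancel₀ _ hl0.ne'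
      set A := (eulerStep K l)^[m] x
      set B := (eulerStep K l)^[m + 1] x with hB
      set C := (eulerStep K μ)^[n] x
      have hBA : B = eulerStep K l A := by rw [hB, Function.iterate_succ_apply']
      -- The resolvent identity turns B into a μ-step from a mean of A and B, so the squared error
      -- obeys the recursion of a random walk jumping by l with probability a = μ / l. Its mean nμ
      -- and variance nμ(l - μ) are the terms of the bound.
      have hBs : B = eulerStep K μ (a • A + (1 - a) • B) := by
        rw [hBA]; exact (hK.eulerStep_resolvent hμ hl A).symm
      rw [Function.iterate_succ_apply' (eulerStep K μ)]
      have h1 : ‖B - eulerStep K μ C‖ ≤ ‖a • (A - C) + (1 - a) • (B - C)‖ := by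
        have := hK.norm_eulerStep_sub_le hμ (a • A + (1 - a) • B) C
        rw [← hBs] at this
        convert this using 2
        module
      have h2 : ‖a • (A - C) + (1 - a) • (B - C)‖ ≤ a * ‖A - C‖ + (1 - a) * ‖B - C‖ := by
        refine (norm_add_le _ _).trans_eq ?_
        rw [norm_smul, norm_smul, Real.norm_of_nonneg ha0, Real.norm_of_nonneg (sub_nonneg.2 ha1)]
      have h3 : (a * ‖A - C‖ + (1 - a) * ‖B - C‖) ^ 2
          ≤ a * ‖A - C‖ ^ 2 + (1 - a) * ‖B - C‖ ^ 2 := by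
        nlinarith [mul_nonneg (mul_nonneg ha0 (sub_nonneg.2 ha1)) (sq_nonneg (‖A - C‖ - ‖B - C‖))]
      have h4 := mul_le_mul_of_nonneg_left (ih m) ha0
      have h5 := mul_le_mul_of_nonneg_left (ih (m + 1)) (sub_nonneg.2 ha1)
      calc ‖B - eulerStep K μ C‖ ^ 2 ≤ (a * ‖A - C‖ + (1 - a) * ‖B - C‖) ^ 2 := by
            gcongr; exact h1.trans h2
        _ ≤ _ := h3
        _ ≤ _ := add_le_add h4 h5
        _ = _ := by
          push_cast
          linear_combination ‖p‖ ^ 2 * (-2 * (m + 1) * l + 2 * n * μ + l) * hal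

end Closed

end ConvexFlow

/-! ### Energy and smoothing estimates for the Euler scheme -/

section EulerEstimates

open Filter Topology

variable {H : Type*} [NormedAddCommGroup H] [InnerProductSpace ℝ H] [CompleteSpace H] {K : Set H}
variable (hK : IsFlowGenerator K)
include hK

/-- The left side is ‖y + t p‖² at elapsed time t = (n + 1) h, with y the iterate and p its slope.
It does not increase with n: maximality of p at y gives ⟪q, y⟫ ≤ ⟪p, y⟫ for the next slope q, and
monotonicity gives ‖q‖ ≤ ‖p‖. -/
theorem IsFlowGenerator.euler_energy_le {h : ℝ} (hh : 0 < h) (x : H) (n : ℕ) :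
    ‖(eulerStep K h)^[n + 1] x‖ ^ 2
      + 2 * ((n + 1) * h) *
        inner ℝ (eulerSlope K h ((eulerStep K h)^[n] x)) ((eulerStep K h)^[n + 1] x)
      + ((n + 1) * h) ^ 2 * ‖eulerSlope K h ((eulerStep K h)^[n] x)‖ ^ 2 ≤ ‖x‖ ^ 2 := by
  have expand : ∀ z : H, ‖z‖ ^ 2 = ‖eulerStep K h z‖ ^ 2
      + 2 * h * inner ℝ (eulerSlope K h z) (eulerStep K h z) + h ^ 2 * ‖eulerSlope K h z‖ ^ 2 := by
    intro z
    conv_lhs => rw [← eulerStep_add_smul (K := K) h z]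
    rw [norm_add_sq_real, real_inner_smul_right, norm_smul, Real.norm_of_nonneg hh.le,
      real_inner_comm]
    ring
  induction n with
  | zero =>
    simp only [Function.iterate_zero, id, zero_add, Function.iterate_one, Nat.cast_zero, one_mul]
    exact (expand x).ge
  | succ n ih =>
    refine le_trans ?_ ih
    rw [Function.iterate_succ_apply' _ (n + 1)]
    have hp := hK.eulerSlope_mem hh ((eulerStep K h)^[n] x)
    rw [← Function.iterate_succ_apply' (eulerStep K h) n] at hp
    set y := (eulerStep K h)^[n + 1] x
    set p := eulerSlope K h ((eulerStep K h)^[n] x)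
    have hq := hK.eulerSlope_mem hh y
    have hy : y = eulerStep K h y + h • eulerSlope K h y := (eulerStep_add_smul h y).symm
    have e := expand y
    have h1 := hp.2 _ hq.1
    have h2 := supportFace_monotone hp hq
    set z := eulerStep K h y
    set q := eulerSlope K h y
    have h3 : inner ℝ q y = inner ℝ q z + h * ‖q‖ ^ 2 := by
      conv_lhs => rw [hy]
      rw [inner_add_right, real_inner_smul_right, real_inner_self_eq_norm_sq]
    have h4 : y - z = h • q := by rw [hy]; abel
    rw [h4, real_inner_smul_right, inner_sub_left, real_inner_self_eq_norm_sq] at h2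
    have h5 : ‖q‖ ^ 2 ≤ inner ℝ p q := by
      have := nonneg_of_mul_nonneg_right h2 hh
      linarith
    have h6 : ‖q‖ ≤ ‖p‖ := by
      by_contra! hlt
      have := real_inner_le_norm p q
      nlinarith [norm_nonneg p]
    have h7 : ‖q‖ ^ 2 ≤ ‖p‖ ^ 2 := by gcongr
    rw [h3] at h1
    have hn : (0 : ℝ) ≤ (n + 1) * h := by positivity
    have h8 := mul_le_mul_of_nonneg_left h1 hn
    have h9 := mul_le_mul_of_nonneg_left h7 (sq_nonneg ((n + 1) * h))
    push_cast
    nlinarith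

/-- Discrete smoothing effect. As 0 ∈ K, the pairing of slope and iterate is nonnegative and can be
dropped from the energy inequality. -/
theorem IsFlowGenerator.norm_eulerSlope_iterate_le {h : ℝ} (hh : 0 < h) (x : H) (n : ℕ) :
    (n + 1) * h * ‖eulerSlope K h ((eulerStep K h)^[n] x)‖ ≤ ‖x‖ := by
  have h1 := hK.euler_energy_le hh x n
  have h2 := (hK.eulerSlope_mem hh ((eulerStep K h)^[n] x)).2 0 hK.zero_mem
  rw [inner_zero_left, ← Function.iterate_succ_apply' (eulerStep K h) n] at h2
  refine le_of_sq_le_sq ?_ (norm_nonneg _)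
  have h3 : (0 : ℝ) ≤ 2 * ((n + 1) * h) := by positivity
  nlinarith [mul_nonneg h3 h2, sq_nonneg ‖(eulerStep K h)^[n + 1] x‖]

theorem IsFlowGenerator.mul_inner_iterate_le {h : ℝ} (hh : 0 < h) (x : H) (n : ℕ) {k : H}
    (hk : k ∈ K) : 2 * (n * h) * inner ℝ k ((eulerStep K h)^[n] x)
      ≤ ‖x‖ ^ 2 - ‖(eulerStep K h)^[n] x‖ ^ 2 := by
  rcases n with _ | n
  · simp
  · have h1 := hK.euler_energy_le hh x n
    have h2 := (hK.eulerSlope_mem hh ((eulerStep K h)^[n] x)).2 k hk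
    rw [← Function.iterate_succ_apply' (eulerStep K h) n] at h2
    have h3 : (0 : ℝ) ≤ 2 * ((n + 1) * h) := by positivity
    have h4 := mul_le_mul_of_nonneg_left h2 h3
    have h5 := mul_nonneg (sq_nonneg ((n + 1) * h))
      (sq_nonneg ‖eulerSlope K h ((eulerStep K h)^[n] x)‖)
    push_cast
    linarith

/-- The mean velocity is an average of slopes, which convexity keeps in K. -/
theorem IsFlowGenerator.exists_sub_iterate_eq_smul {h : ℝ} (hh : 0 < h) (x : H) (n : ℕ) :
    ∃ q ∈ K, x - (eulerStep K h)^[n] x = (n * h) • q := by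
  induction n with
  | zero => exact ⟨0, hK.zero_mem, by simp⟩
  | succ n ih =>
    obtain ⟨q, hq, e⟩ := ih
    have hp := (hK.eulerSlope_mem hh ((eulerStep K h)^[n] x)).1
    have hn : (0 : ℝ) < n + 1 := by positivity
    refine ⟨_, hK.convex hq hp (a := n / (n + 1)) (b := 1 / (n + 1)) (by positivity)
      (by positivity) (by field_simp), ?_⟩
    have e2 := eulerStep_add_smul (K := K) h ((eulerStep K h)^[n] x)
    rw [Function.iterate_succ_apply']
    set p := eulerSlope K h ((eulerStep K h)^[n] x)
    have e3 : x - eulerStep K h ((eulerStep K h)^[n] x) = (n * h) • q + h • p := by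
      rw [← e, ← sub_eq_of_eq_add e2.symm]; abel
    rw [e3, smul_add, smul_smul, smul_smul]
    push_cast
    congr 2 <;> field_simp

theorem IsFlowGenerator.mul_norm_iterate_add_sub_iterate_le {h : ℝ} (hh : 0 < h) (x : H)
    (n m : ℕ) : n * h * ‖(eulerStep K h)^[n + m] x - (eulerStep K h)^[n] x‖ ≤ m * h * ‖x‖ := by
  rcases n with _ | n
  · have : 0 ≤ m * h * ‖x‖ := by positivity
    simpa using this
  · have hp := hK.eulerSlope_mem hh ((eulerStep K h)^[n] x)
    rw [← Function.iterate_succ_apply' (eulerStep K h) n] at hp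
    have h1 := hK.norm_iterate_eulerStep_sub_self_le hh hp m
    rw [← Function.iterate_add_apply, add_comm m] at h1
    have h2 := hK.norm_eulerSlope_iterate_le hh x n
    have h3 : (0 : ℝ) ≤ (n + 1) * h := by positivity
    have h4 : 0 ≤ m * h := by positivity
    push_cast
    calc _ ≤ (n + 1) * h * (m * (h * ‖eulerSlope K h ((eulerStep K h)^[n] x)‖)) := by gcongr
      _ = m * h * ((n + 1) * h * ‖eulerSlope K h ((eulerStep K h)^[n] x)‖) := by ring
      _ ≤ _ := by gcongr

end EulerEstimates

/-! ### The limit semigroup -/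

section Flow

open Filter Topology

variable {H : Type*} [NormedAddCommGroup H] [InnerProductSpace ℝ H] {K : Set H}

/-- The implicit Euler approximation at time `t` with step size `1 / (N + 1)`. -/
noncomputable def eulerApprox (K : Set H) (t : ℝ) (N : ℕ) (x : H) : H :=
  (eulerStep K (1 / (N + 1)))^[⌊t * (N + 1)⌋₊] x

/-- The flow generated by `K`: the limit of the implicit Euler approximations. -/
noncomputable def flow (K : Set H) (t : ℝ) (x : H) : H :=
  limUnder atTop fun N => eulerApprox K t N x

theorem floor_mul_le {t : ℝ} (ht : 0 ≤ t) (N : ℕ) :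
    ⌊t * (N + 1)⌋₊ * (1 / ((N : ℝ) + 1)) ≤ t := by
  rw [mul_one_div, div_le_iff₀ (by positivity)]
  exact Nat.floor_le (by positivity)

theorem sub_le_floor_mul (t : ℝ) (N : ℕ) :
    t - 1 / ((N : ℝ) + 1) ≤ ⌊t * (N + 1)⌋₊ * (1 / ((N : ℝ) + 1)) := by
  have h := Nat.lt_floor_add_one (t * (N + 1))
  rw [mul_one_div, sub_le_iff_le_add, ← add_div, le_div_iff₀ (by positivity)]
  exact h.le

theorem tendsto_floor_mul {t : ℝ} (ht : 0 ≤ t) :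
    Tendsto (fun N : ℕ => ⌊t * (N + 1)⌋₊ * (1 / ((N : ℝ) + 1))) atTop (𝓝 t) := by
  refine tendsto_of_tendsto_of_tendsto_of_le_of_le ?_ tendsto_const_nhds
    (sub_le_floor_mul t) (floor_mul_le ht)
  simpa using tendsto_const_nhds.sub (tendsto_one_div_add_atTop_nhds_zero_nat (𝕜 := ℝ))

variable [CompleteSpace H] (hK : IsFlowGenerator K)
include hK

theorem IsFlowGenerator.norm_eulerApprox_sub_le (t : ℝ) (N : ℕ) (x y : H) :
    ‖eulerApprox K t N x - eulerApprox K t N y‖ ≤ ‖x - y‖ :=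
  hK.norm_iterate_eulerStep_sub_le (by positivity) _ _ _

theorem IsFlowGenerator.norm_eulerApprox_sub_sq_le {t : ℝ} (ht : 0 ≤ t) {x p : H}
    (hp : p ∈ supportFace K x) {N M : ℕ} (h : N ≤ M) :
    ‖eulerApprox K t N x - eulerApprox K t M x‖ ^ 2
      ≤ ‖p‖ ^ 2 * ((1 / ((N : ℝ) + 1)) ^ 2 + t * (1 / ((N : ℝ) + 1))) := by
  have hμ : (0 : ℝ) < 1 / ((M : ℝ) + 1) := by positivity
  have hl : 1 / ((M : ℝ) + 1) ≤ 1 / ((N : ℝ) + 1) := by gcongr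
  refine (hK.norm_iterate_sub_iterate_sq_le hμ hl hp _ _).trans ?_
  have h1 := floor_mul_le ht N
  have h2 := floor_mul_le ht M
  have h3 := sub_le_floor_mul t N
  have h4 := sub_le_floor_mul t M
  set a := 1 / ((N : ℝ) + 1)
  set b := 1 / ((M : ℝ) + 1)
  -- Both elapsed times lie in [t - a, t], because b ≤ a.
  have h5 : (⌊t * (N + 1)⌋₊ * a - ⌊t * (M + 1)⌋₊ * b) ^ 2 ≤ a ^ 2 :=
    sq_le_sq' (by linarith) (by linarith)
  have h6 : ⌊t * (M + 1)⌋₊ * b * (a - b) ≤ t * a := by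
    have : 0 ≤ a - b := sub_nonneg.2 hl
    calc _ ≤ t * (a - b) := by gcongr
      _ ≤ t * a := by gcongr; linarith
  gcongr

theorem IsFlowGenerator.cauchySeq_eulerApprox_of_mem {t : ℝ} (ht : 0 ≤ t) {x p : H}
    (hp : p ∈ supportFace K x) : CauchySeq fun N => eulerApprox K t N x := by
  refine cauchySeq_of_le_tendsto_0'
    (fun N : ℕ => √(‖p‖ ^ 2 * ((1 / ((N : ℝ) + 1)) ^ 2 + t * (1 / ((N : ℝ) + 1))))) ?_ ?_
  · intro N M h
    rw [dist_eq_norm]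
    exact Real.le_sqrt_of_sq_le (hK.norm_eulerApprox_sub_sq_le ht hp h)
  · have h := tendsto_one_div_add_atTop_nhds_zero_nat (𝕜 := ℝ)
    have h2 := (((h.pow 2).add (h.const_mul t)).const_mul (‖p‖ ^ 2)).sqrt
    rwa [zero_pow two_ne_zero, mul_zero, add_zero, mul_zero, Real.sqrt_zero] at h2

variable (hd : Dense {x | (supportFace K x).Nonempty})
include hd

theorem IsFlowGenerator.tendsto_eulerApprox {t : ℝ} (ht : 0 ≤ t) (x : H) :
    Tendsto (fun N => eulerApprox K t N x) atTop (𝓝 (flow K t x)) := by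
  refine CauchySeq.tendsto_limUnder (Metric.cauchySeq_iff.2 fun ε hε => ?_)
  obtain ⟨y, ⟨p, hp⟩, hy⟩ := hd.exists_dist_lt x (show 0 < ε / 3 by positivity)
  obtain ⟨N, hN⟩ := Metric.cauchySeq_iff.1 (hK.cauchySeq_eulerApprox_of_mem ht hp) (ε / 3)
    (by positivity)
  refine ⟨N, fun m hm n hn => ?_⟩
  have h1 := hN m hm n hn
  have h2 := hK.norm_eulerApprox_sub_le t m x y
  have h3 := hK.norm_eulerApprox_sub_le t n y x
  rw [norm_sub_rev y x] at h3
  rw [← dist_eq_norm, ← dist_eq_norm] at h2 h3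
  have h4 := dist_triangle4 (eulerApprox K t m x) (eulerApprox K t m y) (eulerApprox K t n y)
    (eulerApprox K t n x)
  linarith

theorem IsFlowGenerator.norm_flow_sub_flow_le {t : ℝ} (ht : 0 ≤ t) (x y : H) :
    ‖flow K t x - flow K t y‖ ≤ ‖x - y‖ :=
  le_of_tendsto ((hK.tendsto_eulerApprox hd ht x).sub (hK.tendsto_eulerApprox hd ht y)).norm
    (Eventually.of_forall fun N => hK.norm_eulerApprox_sub_le t N x y)

theorem IsFlowGenerator.continuous_flow {t : ℝ} (ht : 0 ≤ t) : Continuous (flow K t) :=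
  (LipschitzWith.of_dist_le_mul (K := 1) fun x y => by
    simpa [dist_eq_norm] using hK.norm_flow_sub_flow_le hd ht x y).continuous

theorem IsFlowGenerator.flow_zero (x : H) : flow K 0 x = x := by
  refine tendsto_nhds_unique (hK.tendsto_eulerApprox hd le_rfl x) ?_
  simp [eulerApprox]

theorem IsFlowGenerator.norm_flow_sub_self_le {t : ℝ} (ht : 0 ≤ t) {x p : H}
    (hp : p ∈ supportFace K x) : ‖flow K t x - x‖ ≤ t * ‖p‖ := by
  refine le_of_tendsto ((hK.tendsto_eulerApprox hd ht x).sub_const x).norm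
    (Eventually.of_forall fun N => ?_)
  refine (hK.norm_iterate_eulerStep_sub_self_le (by positivity) hp _).trans ?_
  rw [← mul_assoc]
  gcongr
  exact floor_mul_le ht N

theorem IsFlowGenerator.mul_inner_flow_le {t : ℝ} (ht : 0 ≤ t) (x : H) {k : H} (hk : k ∈ K) :
    2 * t * inner ℝ k (flow K t x) ≤ ‖x‖ ^ 2 - ‖flow K t x‖ ^ 2 := by
  have h := hK.tendsto_eulerApprox hd ht x
  exact le_of_tendsto_of_tendsto
    (((tendsto_floor_mul ht).const_mul 2).mul (tendsto_const_nhds.inner h))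
    ((h.norm.pow 2).const_sub _)
    (Eventually.of_forall fun N => hK.mul_inner_iterate_le (by positivity) x _ hk)

theorem IsFlowGenerator.inv_smul_sub_flow_mem {t : ℝ} (ht : 0 < t) (x : H) :
    t⁻¹ • (x - flow K t x) ∈ K := by
  have h := hK.tendsto_eulerApprox hd ht.le x
  refine hK.isClosed.mem_of_tendsto
    (((tendsto_floor_mul ht.le).inv₀ ht.ne').smul (h.const_sub x))
    (Eventually.of_forall fun N => ?_)
  obtain ⟨q, hq, e⟩ := hK.exists_sub_iterate_eq_smul (h := 1 / ((N : ℝ) + 1)) (by positivity) x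
    ⌊t * (N + 1)⌋₊
  rw [eulerApprox, e, smul_smul]
  rcases eq_or_ne (⌊t * (N + 1)⌋₊ * (1 / ((N : ℝ) + 1))) 0 with h0 | h0
  · rw [h0]; simpa using hK.zero_mem
  · rwa [inv_mul_cancel₀ h0, one_smul]

theorem IsFlowGenerator.flow_add {s t : ℝ} (hs : 0 ≤ s) (ht : 0 ≤ t) (x : H) :
    flow K (s + t) x = flow K s (flow K t x) := by
  have hcl : IsClosed {x | flow K (s + t) x = flow K s (flow K t x)} :=
    isClosed_eq (hK.continuous_flow hd (add_nonneg hs ht))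
      ((hK.continuous_flow hd hs).comp (hK.continuous_flow hd ht))
  suffices h : {x | (supportFace K x).Nonempty} ⊆ {x | flow K (s + t) x = flow K s (flow K t x)} by
    have := closure_minimal h hcl
    rw [hd.closure_eq] at this
    exact this (mem_univ x)
  rintro x ⟨p, hp⟩
  have h1 := hK.tendsto_eulerApprox hd (add_nonneg hs ht) x
  have h2 := hK.tendsto_eulerApprox hd ht x
  have h3 := hK.tendsto_eulerApprox hd hs (flow K t x)
  refine tendsto_nhds_unique h1 ?_
  refine h3.congr_dist (squeeze_zero (fun _ => dist_nonneg) (g := fun N =>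
    ‖flow K t x - eulerApprox K t N x‖ + 1 / ((N : ℝ) + 1) * ‖p‖) (fun N => ?_) ?_)
  · rw [dist_eq_norm]
    have e1 := hK.norm_eulerApprox_sub_le s N (flow K t x) (eulerApprox K t N x)
    have hN : (0 : ℝ) < 1 / ((N : ℝ) + 1) := by positivity
    -- The floors are additive up to one extra step, and that step moves the iterate by at most the
    -- step size times ‖p‖.
    obtain ⟨d, hd1, hd2⟩ : ∃ d, d ≤ 1 ∧
        ⌊(s + t) * (N + 1)⌋₊ = ⌊s * ((N : ℝ) + 1)⌋₊ + ⌊t * (N + 1)⌋₊ + d := by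
      have hsN : 0 ≤ s * ((N : ℝ) + 1) := by positivity
      have htN : 0 ≤ t * ((N : ℝ) + 1) := by positivity
      have a1 := Nat.floor_le hsN
      have a2 := Nat.floor_le htN
      have a3 := Nat.lt_floor_add_one (s * ((N : ℝ) + 1))
      have a4 := Nat.lt_floor_add_one (t * ((N : ℝ) + 1))
      have b1 : ⌊s * ((N : ℝ) + 1)⌋₊ + ⌊t * ((N : ℝ) + 1)⌋₊ ≤ ⌊(s + t) * ((N : ℝ) + 1)⌋₊ := by
        apply Nat.le_floor
        push_cast
        linarith
      have b2 : ⌊(s + t) * ((N : ℝ) + 1)⌋₊ < ⌊s * ((N : ℝ) + 1)⌋₊ + ⌊t * ((N : ℝ) + 1)⌋₊ + 2 := by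
        rw [Nat.floor_lt (by positivity)]
        push_cast
        linarith
      exact ⟨⌊(s + t) * ((N : ℝ) + 1)⌋₊ - (⌊s * ((N : ℝ) + 1)⌋₊ + ⌊t * ((N : ℝ) + 1)⌋₊),
        by omega, by omega⟩
    have e2 := hK.norm_iterate_add_sub_iterate_le hN hp
      (⌊s * ((N : ℝ) + 1)⌋₊ + ⌊t * (N + 1)⌋₊) d
    rw [← hd2, Function.iterate_add_apply] at e2
    change ‖eulerApprox K (s + t) N x - eulerApprox K s N (eulerApprox K t N x)‖ ≤ _ at e2
    have hd1' : (d : ℝ) ≤ 1 := by exact_mod_cast hd1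
    have e3 : d * (1 / ((N : ℝ) + 1) * ‖p‖) ≤ 1 / ((N : ℝ) + 1) * ‖p‖ :=
      mul_le_of_le_one_left (by positivity) hd1'
    rw [norm_sub_rev] at e2
    have e4 := norm_sub_le_norm_sub_add_norm_sub (eulerApprox K s N (flow K t x))
      (eulerApprox K s N (eulerApprox K t N x)) (eulerApprox K (s + t) N x)
    linarith
  · simpa using (h2.const_sub (flow K t x)).norm.add
      ((tendsto_one_div_add_atTop_nhds_zero_nat (𝕜 := ℝ)).mul_const ‖p‖)

theorem IsFlowGenerator.mul_norm_flow_add_sub_flow_le {t s : ℝ} (ht : 0 ≤ t) (hs : 0 ≤ s) (x : H) :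
    t * ‖flow K (t + s) x - flow K t x‖ ≤ s * ‖x‖ := by
  have h1 := hK.tendsto_eulerApprox hd (add_nonneg ht hs) x
  have h2 := hK.tendsto_eulerApprox hd ht x
  refine le_of_tendsto_of_tendsto ((tendsto_floor_mul ht).mul (h1.sub h2).norm)
    (((tendsto_floor_mul (add_nonneg ht hs)).sub (tendsto_floor_mul ht)).mul_const ‖x‖ |>.trans
      (by rw [add_sub_cancel_left])) (Eventually.of_forall fun N => ?_)
  have hle : ⌊t * ((N : ℝ) + 1)⌋₊ ≤ ⌊(t + s) * ((N : ℝ) + 1)⌋₊ := by gcongr; linarith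
  obtain ⟨m, hm⟩ := Nat.exists_eq_add_of_le hle
  have := hK.mul_norm_iterate_add_sub_iterate_le (h := 1 / ((N : ℝ) + 1)) (by positivity) x
    ⌊t * ((N : ℝ) + 1)⌋₊ m
  rw [← hm] at this
  simp only [eulerApprox]
  refine this.trans_eq ?_
  rw [hm]
  push_cast
  ring

theorem IsFlowGenerator.continuousOn_flow (x : H) : ContinuousOn (fun t => flow K t x) (Ici 0) := by
  -- A trajectory from y with nonempty face is Lipschitz in time; by contraction, replacing x by y
  -- costs 2‖x - y‖.
  have aux : ∀ {s t : ℝ}, 0 ≤ s → s ≤ t → ∀ {y p : H}, p ∈ supportFace K y →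
      ‖flow K t x - flow K s x‖ ≤ 2 * ‖x - y‖ + (t - s) * ‖p‖ := by
    intro s t hs hst y p hp
    have hts : 0 ≤ t - s := sub_nonneg.2 hst
    have e : flow K t x = flow K s (flow K (t - s) x) := by
      rw [← hK.flow_add hd hs hts, add_sub_cancel]
    have h1 := hK.norm_flow_sub_flow_le hd hs (flow K (t - s) x) x
    have h2 := hK.norm_flow_sub_flow_le hd hts x y
    have h3 := hK.norm_flow_sub_self_le hd hts hp
    have h4 := norm_sub_le_norm_sub_add_norm_sub (flow K (t - s) x) (flow K (t - s) y) x
    have h5 := norm_sub_le_norm_sub_add_norm_sub (flow K (t - s) y) y x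
    rw [norm_sub_rev y x] at h5
    rw [e]
    linarith
  refine Metric.continuousOn_iff.2 fun t ht ε hε => ?_
  obtain ⟨y, ⟨p, hp⟩, hy⟩ := hd.exists_dist_lt x (show 0 < ε / 4 by positivity)
  refine ⟨ε / (2 * (‖p‖ + 1)), by positivity, fun s hs hst => ?_⟩
  rw [dist_eq_norm] at hy hst ⊢
  have key : ‖flow K s x - flow K t x‖ ≤ 2 * ‖x - y‖ + ‖s - t‖ * ‖p‖ := by
    rcases le_total t s with h | h
    · rw [Real.norm_of_nonneg (sub_nonneg.2 h)]
      exact aux ht h hp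
    · rw [norm_sub_rev s t, Real.norm_of_nonneg (sub_nonneg.2 h), norm_sub_rev]
      exact aux hs h hp
  have h2 : ‖s - t‖ * ‖p‖ ≤ ε / 2 := by
    rw [lt_div_iff₀ (by positivity)] at hst
    nlinarith [norm_nonneg (s - t)]
  linarith

end Flow

/-! ### Weak compactness and weakly closed sets -/

section WeakLimits

open Filter Topology

variable {H : Type*} [NormedAddCommGroup H] [InnerProductSpace ℝ H]

/-- Banach–Alaoglu along an ultrafilter, which replaces the extraction of subsequences. -/
theorem exists_tendsto_inner_of_norm_le [CompleteSpace H] {ι : Type*} (U : Ultrafilter ι)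
    {f : ι → H} {C : ℝ} (hf : ∀ᶠ i in (U : Filter ι), ‖f i‖ ≤ C) :
    ∃ q : H, ‖q‖ ≤ C ∧
      ∀ y, Tendsto (fun i => inner ℝ (f i) y) (U : Filter ι) (𝓝 (inner ℝ q y)) := by
  let g : ι → WeakDual ℝ H := fun i =>
    StrongDual.toWeakDual (InnerProductSpace.toDual ℝ H (f i))
  have hc := WeakDual.isCompact_closedBall (𝕜 := ℝ) (E := H) 0 C
  have hg : ∀ᶠ i in (U : Filter ι), g i ∈ WeakDual.toStrongDual ⁻¹' Metric.closedBall 0 C := by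
    filter_upwards [hf] with i hi
    simpa [g] using hi
  obtain ⟨l, hl, hU⟩ := hc.ultrafilter_le_nhds' (U.map g) hg
  refine ⟨(InnerProductSpace.toDual ℝ H).symm (WeakDual.toStrongDual l), by simpa using hl,
    fun y => ?_⟩
  have h1 : Tendsto g (U : Filter ι) (𝓝 l) := hU
  have h2 := ((WeakDual.eval_continuous (𝕜 := ℝ) y).tendsto l).comp h1
  simpa [g, Function.comp_def] using h2

/-- Closed convex sets are weakly closed: testing with q - p, where p is the projection of q, forces
q = p. -/
theorem mem_of_tendsto_inner [CompleteSpace H] {K : Set H} (hK : IsClosed K)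
    (hc : Convex ℝ K) {ι : Type*} {l : Filter ι} [l.NeBot] {f : ι → H} {q : H}
    (hf : ∀ᶠ i in l, f i ∈ K)
    (hq : ∀ y, Tendsto (fun i => inner ℝ (f i) y) l (𝓝 (inner ℝ q y))) : q ∈ K := by
  obtain ⟨i, hi⟩ := hf.exists
  obtain ⟨p, hp, hmin⟩ := exists_norm_eq_iInf_of_complete_convex ⟨_, hi⟩ hK.isComplete hc q
  rw [norm_eq_iInf_iff_real_inner_le_zero hc hp] at hmin
  have h1 : inner ℝ q (q - p) - inner ℝ p (q - p) ≤ 0 := by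
    refine le_of_tendsto ((hq (q - p)).sub_const _) ?_
    filter_upwards [hf] with i hi
    rw [← inner_sub_left, real_inner_comm]
    exact hmin _ hi
  rw [← inner_sub_left, real_inner_self_nonpos, sub_eq_zero] at h1
  rwa [h1]

theorem tendsto_inner_of_tendsto_inner_of_tendsto {ι : Type*} {l : Filter ι} {f g : ι → H}
    {q y : H} {C : ℝ} (hf : ∀ᶠ i in l, ‖f i‖ ≤ C)
    (hq : ∀ y, Tendsto (fun i => inner ℝ (f i) y) l (𝓝 (inner ℝ q y)))
    (hg : Tendsto g l (𝓝 y)) : Tendsto (fun i => inner ℝ (f i) (g i)) l (𝓝 (inner ℝ q y)) := by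
  have h1 : Tendsto (fun i => inner ℝ (f i) (g i - y)) l (𝓝 0) := by
    refine squeeze_zero_norm' (a := fun i => C * ‖g i - y‖) ?_ ?_
    · filter_upwards [hf] with i hi
      exact (norm_inner_le_norm _ _).trans (by gcongr)
    · simpa using (tendsto_iff_norm_sub_tendsto_zero.1 hg).const_mul C
  simpa [inner_sub_right] using h1.add (hq y)

theorem exists_minimal_norm [CompleteSpace H] {C : Set H} (hC : IsClosed C) (hc : Convex ℝ C)
    (hne : C.Nonempty) : ∃ p ∈ C, ∀ q ∈ C, ‖p‖ ^ 2 ≤ inner ℝ q p := by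
  obtain ⟨p, hp, hmin⟩ := exists_norm_eq_iInf_of_complete_convex hne hC.isComplete hc 0
  rw [norm_eq_iInf_iff_real_inner_le_zero hc hp] at hmin
  refine ⟨p, hp, fun q hq => ?_⟩
  have := hmin q hq
  rw [zero_sub, inner_neg_left, inner_sub_right, real_inner_self_eq_norm_sq,
    real_inner_comm] at this
  linarith

end WeakLimits

/-! ### Differentiability of the flow off a countable set -/

section FlowDerivative

open Filter Topology

variable {H : Type*} [NormedAddCommGroup H] [InnerProductSpace ℝ H] [CompleteSpace H] {K : Set H}
variable (hK : IsFlowGenerator K) (hd : Dense {x | (supportFace K x).Nonempty})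
include hK hd

theorem IsFlowGenerator.flow_eq_flow_flow {s t : ℝ} (hs : 0 ≤ s) (hst : s ≤ t) (x : H) :
    flow K t x = flow K (t - s) (flow K s x) := by
  rw [← hK.flow_add hd (sub_nonneg.2 hst) hs, sub_add_cancel]

theorem IsFlowGenerator.neg_slope_flow_mem {s t : ℝ} (hs : 0 ≤ s) (ht : 0 ≤ t) (hst : s ≠ t)
    (x : H) : -slope (fun r => flow K r x) t s ∈ K := by
  have aux : ∀ {s t : ℝ}, 0 ≤ s → 0 ≤ t → s < t →
      -slope (fun r => flow K r x) t s ∈ K := by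
    intro s t hs ht h
    have := hK.inv_smul_sub_flow_mem hd (sub_pos.2 h) (flow K s x)
    rw [← hK.flow_eq_flow_flow hd hs h.le] at this
    rw [slope_comm, slope_def_module, ← smul_neg, neg_sub]
    exact this
  rcases hst.lt_or_gt with h | h
  · exact aux hs ht h
  · rw [slope_comm]
    exact aux ht hs h

/-- The energy inequality between the two times, divided by their distance. It pairs k with the
later state, hence `max s t`; the form symmetric in s and t allows two-sided limits. -/
theorem IsFlowGenerator.inner_flow_max_le {s t : ℝ} (hs : 0 ≤ s) (ht : 0 ≤ t) (hst : s ≠ t)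
    (x : H) {k : H} (hk : k ∈ K) : 2 * inner ℝ k (flow K (max s t) x)
      ≤ inner ℝ (-slope (fun r => flow K r x) t s) (flow K t x + flow K s x) := by
  have aux : ∀ {s t : ℝ}, 0 ≤ s → 0 ≤ t → s < t → 2 * inner ℝ k (flow K (max s t) x)
      ≤ inner ℝ (-slope (fun r => flow K r x) t s) (flow K t x + flow K s x) := by
    intro s t hs ht h
    have h0 := sub_pos.2 h
    have := hK.mul_inner_flow_le hd h0.le (flow K s x) hk
    rw [← hK.flow_eq_flow_flow hd hs h.le] at this
    have e : inner ℝ (flow K s x - flow K t x) (flow K t x + flow K s x)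
        = ‖flow K s x‖ ^ 2 - ‖flow K t x‖ ^ 2 := by
      simp only [inner_sub_left, inner_add_right, real_inner_self_eq_norm_sq]
      rw [real_inner_comm (flow K s x)]
      ring
    rw [slope_comm, slope_def_module, max_eq_right h.le, ← smul_neg, neg_sub,
      real_inner_smul_left, e, inv_mul_eq_div, le_div_iff₀ h0]
    linarith
  rcases hst.lt_or_gt with h | h
  · exact aux hs ht h
  · rw [slope_comm, max_comm, add_comm]
    exact aux ht hs h

/-- Membership in K is weak closedness; maximality is the limit of `inner_flow_max_le`. A general
filter covers right-hand limits and ultrafilters alike. -/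
theorem IsFlowGenerator.mem_supportFace_of_tendsto {t : ℝ} (ht : 0 < t) (x : H)
    {l : Filter ℝ} [l.NeBot] (hl : l ≤ 𝓝[≠] t) {C : ℝ} {q : H}
    (hC : ∀ᶠ s in l, ‖-slope (fun r => flow K r x) t s‖ ≤ C)
    (hq : ∀ y, Tendsto (fun s => inner ℝ (-slope (fun r => flow K r x) t s) y) l
      (𝓝 (inner ℝ q y))) : q ∈ supportFace K (flow K t x) := by
  have hpos : ∀ᶠ s in l, 0 < s := hl (mem_nhdsWithin_of_mem_nhds (lt_mem_nhds ht))
  have hne : ∀ᶠ s in l, s ≠ t := hl self_mem_nhdsWithin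
  have hlt : Tendsto id l (𝓝 t) := hl.trans nhdsWithin_le_nhds
  have hcont : ContinuousAt (fun r => flow K r x) t :=
    (hK.continuousOn_flow hd x).continuousAt (Ici_mem_nhds ht)
  refine ⟨mem_of_tendsto_inner hK.isClosed hK.convex (l := l) ?_ hq, fun k hk => ?_⟩
  · filter_upwards [hpos, hne] with s h1 h2
    exact hK.neg_slope_flow_mem hd h1.le ht.le h2 x
  · have h1 : Tendsto (fun s => flow K s x) l (𝓝 (flow K t x)) := hcont.tendsto.comp hlt
    have h2 : Tendsto (fun s => flow K (max s t) x) l (𝓝 (flow K t x)) := by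
      refine hcont.tendsto.comp ?_
      simpa using hlt.max (tendsto_const_nhds (x := t))
    have h3 := tendsto_inner_of_tendsto_inner_of_tendsto hC hq (h1.const_add (flow K t x))
    have h4 : 2 * inner ℝ k (flow K t x) ≤ inner ℝ q (flow K t x + flow K t x) := by
      refine le_of_tendsto_of_tendsto ((tendsto_const_nhds.inner h2).const_mul 2) h3 ?_
      filter_upwards [hpos, hne] with s h1 h2
      exact hK.inner_flow_max_le hd h1.le ht.le h2 x hk
    rw [inner_add_right] at h4
    linarith

theorem IsFlowGenerator.exists_mem_supportFace_flow {t : ℝ} (ht : 0 < t) (x : H) {C : ℝ}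
    (hC : ∀ s > t, ‖flow K s x - flow K t x‖ ≤ C * (s - t)) :
    ∃ q ∈ supportFace K (flow K t x), ‖q‖ ≤ C := by
  have hb : ∀ᶠ s in 𝓝[>] t, ‖-slope (fun r => flow K r x) t s‖ ≤ C := by
    filter_upwards [self_mem_nhdsWithin] with s hs
    have h0 : 0 < s - t := sub_pos.2 hs
    rw [norm_neg, slope_def_module, norm_smul, norm_inv, Real.norm_of_nonneg h0.le,
      inv_mul_le_iff₀ h0, mul_comm]
    exact hC s hs
  have hU : (Ultrafilter.of (𝓝[>] t) : Filter ℝ) ≤ 𝓝[>] t := Ultrafilter.of_le _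
  obtain ⟨q, hqC, hq⟩ := exists_tendsto_inner_of_norm_le _ (hU hb)
  refine ⟨q, hK.mem_supportFace_of_tendsto hd ht x (hU.trans ?_) (hU hb) hq, hqC⟩
  exact nhdsWithin_mono _ fun s hs => ne_of_gt hs

theorem IsFlowGenerator.norm_flow_sub_flow_le_mul {s t : ℝ} (hs : 0 ≤ s) (hst : s ≤ t) (x : H)
    {p : H} (hp : p ∈ supportFace K (flow K s x)) :
    ‖flow K t x - flow K s x‖ ≤ (t - s) * ‖p‖ := by
  rw [hK.flow_eq_flow_flow hd hs hst]
  exact hK.norm_flow_sub_self_le hd (sub_nonneg.2 hst) hp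

theorem IsFlowGenerator.norm_flow_sub_flow_le_div {s t : ℝ} (hs : 0 < s) (hst : s ≤ t) (x : H) :
    ‖flow K t x - flow K s x‖ ≤ ‖x‖ / s * (t - s) := by
  have := hK.mul_norm_flow_add_sub_flow_le hd hs.le (sub_nonneg.2 hst) x
  rw [add_sub_cancel] at this
  rw [div_mul_eq_mul_div, le_div_iff₀ hs]
  linarith

/-- Let p t be the element of minimal norm in the face at time t. Its norm is antitone, hence
continuous off a countable set; at continuity points it bounds the difference quotients sharply
enough to make their weak convergence strong. -/
theorem IsFlowGenerator.exists_countable_hasDerivAt_flow (x : H) :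
    ∃ S : Set ℝ, S.Countable ∧ ∀ t, 0 < t → t ∉ S →
      ∃ p ∈ supportFace K (flow K t x), HasDerivAt (fun r => flow K r x) (-p) t := by
  have hne : ∀ t : ℝ, ∃ p : H, 0 < t → p ∈ supportFace K (flow K t x) ∧
      ∀ q ∈ supportFace K (flow K t x), ‖p‖ ^ 2 ≤ inner ℝ q p := by
    intro t
    by_cases ht : 0 < t
    · obtain ⟨q, hq, -⟩ := hK.exists_mem_supportFace_flow hd ht x
        fun s hs => hK.norm_flow_sub_flow_le_div hd ht (le_of_lt hs) x
      obtain ⟨p, hp, h⟩ := exists_minimal_norm (isClosed_supportFace hK.isClosed (flow K t x))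
        (convex_supportFace hK.convex _) ⟨q, hq⟩
      exact ⟨p, fun _ => ⟨hp, h⟩⟩
    · exact ⟨0, fun h => absurd h ht⟩
  choose p hp using hne
  have hanti : AntitoneOn (fun t => ‖p t‖) (Ioi 0) := by
    intro s hs t ht hst
    -- The increment over [t, r] is the increment over [s, s + (r - t)] transported by the
    -- contraction `flow K (t - s)`.
    obtain ⟨q, hq, hqC⟩ := hK.exists_mem_supportFace_flow hd (C := ‖p s‖) ht x fun r hr => by
      have hts : 0 ≤ t - s := sub_nonneg.2 hst
      have e1 : flow K r x = flow K (t - s) (flow K (s + (r - t)) x) := by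
        rw [← hK.flow_add hd hts (by linarith [mem_Ioi.1 hs])]
        congr 1; ring
      rw [e1, hK.flow_eq_flow_flow hd (le_of_lt hs) hst]
      refine (hK.norm_flow_sub_flow_le hd hts _ _).trans ?_
      have := hK.norm_flow_sub_flow_le_mul hd (le_of_lt hs)
        (show s ≤ s + (r - t) by linarith) x (hp s hs).1
      linarith
    have h1 := (hp t ht).2 q hq
    have h2 := real_inner_le_norm q (p t)
    change ‖p t‖ ≤ ‖p s‖
    by_contra! hlt
    nlinarith [norm_nonneg (p s), norm_nonneg q]
  refine ⟨_, hanti.countable_not_continuousWithinAt, fun t ht htS => ⟨p t, (hp t ht).1, ?_⟩⟩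
  have hcont : ContinuousAt (fun t => ‖p t‖) t := by
    by_contra hc
    exact htS ⟨ht, fun h => hc (h.continuousAt (Ioi_mem_nhds ht))⟩
  have hb : ∀ᶠ s in 𝓝[≠] t, ‖-slope (fun r => flow K r x) t s‖ ≤ ‖p (min s t)‖ := by
    filter_upwards [self_mem_nhdsWithin, mem_nhdsWithin_of_mem_nhds (lt_mem_nhds ht)] with s hst hs
    have aux : ∀ {s t : ℝ}, 0 < s → s < t →
        ‖-slope (fun r => flow K r x) t s‖ ≤ ‖p (min s t)‖ := by
      intro s t hs hst
      have h0 := sub_pos.2 hst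
      rw [slope_comm, norm_neg, slope_def_module, norm_smul, norm_inv, Real.norm_of_nonneg h0.le,
        inv_mul_le_iff₀ h0, min_eq_left hst.le]
      exact hK.norm_flow_sub_flow_le_mul hd hs.le hst.le x (hp s hs).1
    rcases lt_or_gt_of_ne hst with h | h
    · exact aux hs h
    · rw [slope_comm, min_comm]
      exact aux ht h
  have hmin : Tendsto (fun s => ‖p (min s t)‖) (𝓝[≠] t) (𝓝 ‖p t‖) := by
    refine hcont.tendsto.comp ?_
    have : Tendsto (fun s : ℝ => min s t) (𝓝 t) (𝓝 (min t t)) :=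
      tendsto_id.min tendsto_const_nhds
    rw [min_self] at this
    exact this.mono_left nhdsWithin_le_nhds
  have hbC : ∀ᶠ s in 𝓝[≠] t, ‖-slope (fun r => flow K r x) t s‖ ≤ ‖p t‖ + 1 := by
    filter_upwards [hb, hmin.eventually (gt_mem_nhds (lt_add_one _))] with s h1 h2
    exact h1.trans h2.le
  suffices h : Tendsto (fun s => -slope (fun r => flow K r x) t s) (𝓝[≠] t) (𝓝 (p t)) by
    rw [hasDerivAt_iff_tendsto_slope]
    simpa using h.neg
  rw [tendsto_iff_ultrafilter]
  intro U hU
  obtain ⟨q, -, hq⟩ := exists_tendsto_inner_of_norm_le U (hU hbC)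
  have hqmem := hK.mem_supportFace_of_tendsto hd ht x hU (hU hbC) hq
  have hle := (hp t ht).2 q hqmem
  have hlim := (((hmin.mono_left hU).pow 2).sub ((hq (p t)).const_mul 2)).add_const (‖p t‖ ^ 2)
  have hbound : ∀ᶠ s in (U : Filter ℝ), ‖-slope (fun r => flow K r x) t s - p t‖ ^ 2
      ≤ ‖p (min s t)‖ ^ 2 - 2 * inner ℝ (-slope (fun r => flow K r x) t s) (p t) + ‖p t‖ ^ 2 := by
    filter_upwards [hU hb] with s hs
    rw [norm_sub_sq_real]
    gcongr
  -- Minimality gives ‖p t‖² ≤ ⟪q, p t⟫, so the limit of the upper bounds for the squared distance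
  -- to p t is at most 0.
  have h0 : ‖p t‖ ^ 2 - 2 * inner ℝ q (p t) + ‖p t‖ ^ 2 = 0 := by
    refine le_antisymm (by linarith) (ge_of_tendsto hlim ?_)
    filter_upwards [hbound] with s hs
    exact (sq_nonneg _).trans hs
  rw [h0] at hlim
  have hsq := squeeze_zero' (Eventually.of_forall fun s => sq_nonneg _) hbound hlim
  have hfin := hsq.sqrt
  simp only [Real.sqrt_sq (norm_nonneg _), Real.sqrt_zero] at hfin
  exact tendsto_iff_norm_sub_tendsto_zero.2 hfin

end FlowDerivative

/-! ### Density of the points with nonempty face -/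

section Density

open Filter Topology

variable {H : Type*} [NormedAddCommGroup H] [InnerProductSpace ℝ H]

/-- The vectors on which `K` is bounded. -/
def boundedOn (K : Set H) : Submodule ℝ H where
  carrier := {x | ∃ M : ℝ, ∀ k ∈ K, |inner ℝ k x| ≤ M}
  add_mem' := by
    rintro x y ⟨M, hM⟩ ⟨N, hN⟩
    refine ⟨M + N, fun k hk => ?_⟩
    rw [inner_add_right]
    exact (abs_add_le _ _).trans (add_le_add (hM k hk) (hN k hk))
  zero_mem' := ⟨0, by simp⟩
  smul_mem' := by
    rintro c x ⟨M, hM⟩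
    refine ⟨|c| * M, fun k hk => ?_⟩
    rw [real_inner_smul_right, abs_mul]
    exact mul_le_mul_of_nonneg_left (hM k hk) (abs_nonneg c)

/-- If K is bounded by M on x, the slope p of an h-step satisfies h‖p‖² ≤ ⟪p, x⟫ ≤ M, so the step,
which ends at a point with nonempty face, moves x by at most √(hM). -/
theorem IsFlowGenerator.dense_supportFace_nonempty [CompleteSpace H] {K : Set H}
    (hK : IsFlowGenerator K) (hd : Dense (boundedOn K : Set H)) :
    Dense {x | (supportFace K x).Nonempty} := by
  refine dense_iff_closure_eq.2 (eq_univ_of_univ_subset ?_)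
  rw [← hd.closure_eq]
  refine closure_minimal ?_ isClosed_closure
  rintro x ⟨M, hM⟩
  refine mem_closure_of_tendsto (f := fun n : ℕ => eulerStep K (1 / ((n : ℝ) + 1)) x) (b := atTop)
    ?_ (Eventually.of_forall fun n => ⟨_, hK.eulerSlope_mem (by positivity) x⟩)
  have hlim := ((tendsto_one_div_add_atTop_nhds_zero_nat (𝕜 := ℝ)).mul_const M).sqrt
  rw [zero_mul, Real.sqrt_zero] at hlim
  refine tendsto_iff_norm_sub_tendsto_zero.2
    (squeeze_zero (fun _ => norm_nonneg _) (fun n => Real.le_sqrt_of_sq_le ?_) hlim)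
  set h : ℝ := 1 / ((n : ℝ) + 1)
  have hh : 0 < h := by positivity
  have hp := hK.eulerSlope_mem hh x
  have h1 := hp.2 0 hK.zero_mem
  have h2 := (le_abs_self _).trans (hM _ hp.1)
  have e := eulerStep_add_smul (K := K) h x
  set p := eulerSlope K h x
  rw [← e, inner_add_right, real_inner_smul_right, real_inner_self_eq_norm_sq] at h2
  rw [inner_zero_left] at h1
  have h3 : ‖eulerStep K h x - x‖ = h * ‖p‖ := by
    rw [norm_sub_rev, sub_eq_of_eq_add' e.symm, norm_smul, Real.norm_of_nonneg hh.le]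
  rw [h3]
  nlinarith

end Density

/-! ### Total variation as a support function -/

section Divergence

theorem continuous_divergence {φ : Plane → Plane} (hφ : ContDiff ℝ 1 φ) :
    Continuous (divergence φ) := by
  have := hφ.continuous_fderiv one_ne_zero
  unfold divergence
  fun_prop

theorem hasCompactSupport_divergence {φ : Plane → Plane} (hφ : HasCompactSupport φ) :
    HasCompactSupport (divergence φ) :=
  (hφ.fderiv (𝕜 := ℝ)).mono' fun x hx => subset_tsupport _ fun h => hx (by simp [divergence, h])

theorem divergence_add_smul {φ ψ : Plane → Plane} (hφ : Differentiable ℝ φ)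
    (hψ : Differentiable ℝ ψ) (a b : ℝ) (x : Plane) :
    divergence (a • φ + b • ψ) x = a * divergence φ x + b * divergence ψ x := by
  have h : fderiv ℝ (a • φ + b • ψ) x = a • fderiv ℝ φ x + b • fderiv ℝ ψ x := by
    rw [fderiv_add ((hφ x).const_smul a) ((hψ x).const_smul b), fderiv_const_smul (hφ x),
      fderiv_const_smul (hψ x)]
  simp only [divergence, h, Finset.mul_sum, ← Finset.sum_add_distrib]
  rfl

theorem inner_gradient_eq_sum (w : Plane → ℝ) (v x : Plane) :
    inner ℝ v (gradient w x) = ∑ i : Fin 2, v i * fderiv ℝ w x (EuclideanSpace.single i 1) := by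
  rw [gradient, real_inner_comm, InnerProductSpace.toDual_symm_apply]
  conv_lhs => rw [← (EuclideanSpace.basisFun (Fin 2) ℝ).sum_repr v]
  simp

/-- Integration by parts for a compactly supported vector field. -/
theorem integral_divergence_mul {φ : Plane → Plane} (hφ : ContDiff ℝ 1 φ)
    (hφc : HasCompactSupport φ) {w : Plane → ℝ} (hw : ContDiff ℝ 1 w) :
    ∫ x, divergence φ x * w x = -∫ x, inner ℝ (φ x) (gradient w x) := by
  have hφ' := hφ.continuous_fderiv one_ne_zero
  have hw' := hw.continuous_fderiv one_ne_zero
  have hφ0 := hφ.continuous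
  have hw0 := hw.continuous
  have hfd : ∀ i x v, fderiv ℝ (fun y => φ y i) x v = fderiv ℝ φ x v i := by
    intro i x v
    have h1 := ((EuclideanSpace.proj i : Plane →L[ℝ] ℝ).hasFDerivAt.comp x
      (hφ.differentiable one_ne_zero x).hasFDerivAt)
    have h2 : fderiv ℝ (fun y => φ y i) x = _ := h1.fderiv
    rw [h2]; rfl
  have hs : ∀ x, φ x = 0 → ∀ i, φ x i = 0 := fun x h i => by rw [h]; rfl
  have hs' : ∀ x, fderiv ℝ φ x = 0 → ∀ i v, fderiv ℝ φ x v i = 0 := fun x h i v => by rw [h]; rfl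
  have hi1 : ∀ i : Fin 2, Integrable fun x =>
      fderiv ℝ φ x (EuclideanSpace.single i 1) i * w x := fun i =>
    (by fun_prop : Continuous _).integrable_of_hasCompactSupport
      ((hφc.fderiv (𝕜 := ℝ)).mono' fun x hx => subset_tsupport _ fun h =>
        hx (by simp [hs' x h]))
  have hi2 : ∀ i : Fin 2, Integrable fun x =>
      φ x i * fderiv ℝ w x (EuclideanSpace.single i 1) := fun i =>
    (by fun_prop : Continuous _).integrable_of_hasCompactSupport
      (hφc.mono' fun x hx => subset_tsupport _ fun h => hx (by simp [hs x h]))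
  have hi3 : ∀ i : Fin 2, Integrable fun x => φ x i * w x := fun i =>
    (by fun_prop : Continuous _).integrable_of_hasCompactSupport
      (hφc.mono' fun x hx => subset_tsupport _ fun h => hx (by simp [hs x h]))
  simp only [inner_gradient_eq_sum, divergence, Finset.sum_mul]
  rw [integral_finsetSum _ fun i _ => hi1 i, integral_finsetSum _ fun i _ => hi2 i,
    ← Finset.sum_neg_distrib]
  refine Finset.sum_congr rfl fun i _ => ?_
  have := integral_mul_fderiv_eq_neg_fderiv_mul_of_integrable (μ := (volume : Measure Plane))
    (f := fun y => φ y i) (g := w) (v := EuclideanSpace.single i 1)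
    (by simpa only [hfd] using hi1 i) (hi2 i) (hi3 i)
    (fun x _ => by have := hφ.differentiable one_ne_zero; fun_prop)
    (fun x _ => hw.differentiable one_ne_zero x)
  simp only [hfd] at this
  rw [this, neg_neg]

variable {Ω : Opens Plane}

theorem setIntegral_divergence_mul (φ : 𝓓(Ω, Plane)) {w : Plane → ℝ} (hw : ContDiff ℝ 1 w) :
    ∫ x in (Ω : Set Plane), divergence φ x * w x
      = -∫ x in (Ω : Set Plane), inner ℝ (φ x) (gradient w x) := by
  have h0 : ∀ x ∉ (Ω : Set Plane), x ∉ tsupport φ := fun x hx h => hx (φ.tsupport_subset h)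
  rw [setIntegral_eq_integral_of_forall_compl_eq_zero fun x hx => ?_,
    setIntegral_eq_integral_of_forall_compl_eq_zero fun x hx => ?_]
  · exact integral_divergence_mul (φ.contDiff.of_le (by simp)) φ.hasCompactSupport hw
  · rw [image_eq_zero_of_notMem_tsupport (h0 x hx), inner_zero_left]
  · have : fderiv ℝ φ x = 0 := by
      by_contra h
      exact h0 x hx (support_fderiv_subset ℝ h)
    simp [divergence, this]

theorem memLp_of_continuous_hasCompactSupport {E : Type*} [NormedAddCommGroup E] {f : Plane → E}
    (hf : Continuous f) (hc : HasCompactSupport f) :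
    MemLp f 2 (volume.restrict (Ω : Set Plane)) :=
  (hf.memLp_of_hasCompactSupport hc).restrict _

theorem memLp_divergence (φ : 𝓓(Ω, Plane)) :
    MemLp (divergence φ) 2 (volume.restrict (Ω : Set Plane)) :=
  memLp_of_continuous_hasCompactSupport (continuous_divergence (φ.contDiff.of_le (by simp)))
    (hasCompactSupport_divergence φ.hasCompactSupport)

/-- The divergence of a test vector field, as an element of `L²(Ω)`. -/
noncomputable def divL2 (φ : 𝓓(Ω, Plane)) : L2 Ω := (memLp_divergence φ).toLp _

theorem inner_toLp_left {f : Plane → ℝ} (hf : MemLp f 2 (volume.restrict (Ω : Set Plane)))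
    (u : L2 Ω) : inner ℝ (hf.toLp f) u = ∫ x in (Ω : Set Plane), u x * f x := by
  rw [L2.inner_def]
  refine integral_congr_ae ?_
  filter_upwards [hf.coeFn_toLp] with x hx
  rw [hx]
  rfl

variable (Ω) in
/-- The closure in `L²(Ω)` of the divergences of the admissible test fields of `J_TV`. -/
def tvPolar : Set (L2 Ω) := closure (divL2 '' {φ : 𝓓(Ω, Plane) | ∀ x, ‖φ x‖ ≤ 1})

theorem isFlowGenerator_tvPolar : IsFlowGenerator (tvPolar Ω) where
  isClosed := isClosed_closure
  convex := by
    refine Convex.closure ?_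
    rintro _ ⟨φ, hφ, rfl⟩ _ ⟨ψ, hψ, rfl⟩ a b ha hb hab
    refine ⟨a • φ + b • ψ, fun x => ?_, ?_⟩
    · calc ‖(a • φ + b • ψ) x‖ ≤ ‖a • φ x‖ + ‖b • ψ x‖ := norm_add_le _ _
        _ = a * ‖φ x‖ + b * ‖ψ x‖ := by
          rw [norm_smul, norm_smul, Real.norm_of_nonneg ha, Real.norm_of_nonneg hb]
        _ ≤ a * 1 + b * 1 := by gcongr; exacts [hφ x, hψ x]
        _ = 1 := by linarith
    · refine Lp.ext ?_
      filter_upwards [(memLp_divergence (a • φ + b • ψ)).coeFn_toLp, (memLp_divergence φ).coeFn_toLp,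
        (memLp_divergence ψ).coeFn_toLp, Lp.coeFn_add (a • divL2 φ) (b • divL2 ψ),
        Lp.coeFn_smul a (divL2 φ), Lp.coeFn_smul b (divL2 ψ)] with x h1 h2 h3 h4 h5 h6
      rw [h4, Pi.add_apply, h5, h6, Pi.smul_apply, Pi.smul_apply, divL2, divL2, divL2, h1, h2, h3]
      exact divergence_add_smul (φ.contDiff.differentiable (by simp))
        (ψ.contDiff.differentiable (by simp)) a b x
  zero_mem := by
    refine subset_closure ⟨0, by simp, ?_⟩
    refine Lp.ext ?_
    filter_upwards [(memLp_divergence (0 : 𝓓(Ω, Plane))).coeFn_toLp,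
      Lp.coeFn_zero ℝ 2 (volume.restrict (Ω : Set Plane))] with x h1 h2
    rw [divL2, h1, h2]
    have : ((0 : 𝓓(Ω, Plane)) : Plane → Plane) = 0 := rfl
    simp [divergence, this]

/-- Pairing with u is continuous, so taking the closure does not change the supremum. -/
theorem totalVariation_le_iff {u : L2 Ω} {M : ℝ} :
    totalVariation Ω u ≤ M ↔ ∀ k ∈ tvPolar Ω, inner ℝ k u ≤ M := by
  have hcl : IsClosed {k : L2 Ω | inner ℝ k u ≤ M} :=
    isClosed_le (continuous_id.inner continuous_const) continuous_const
  constructor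
  · intro h k hk
    refine closure_minimal ?_ hcl hk
    rintro _ ⟨φ, hφ, rfl⟩
    have := (iSup_le_iff.1 h) ⟨φ, hφ⟩
    rw [EReal.coe_le_coe_iff] at this
    rwa [mem_ofPred_eq, divL2, inner_toLp_left]
  · intro h
    refine iSup_le fun φ => ?_
    rw [EReal.coe_le_coe_iff]
    have := h _ (subset_closure ⟨φ.1, φ.2, rfl⟩)
    rwa [divL2, inner_toLp_left] at this

theorem totalVariation_nonneg (u : L2 Ω) : 0 ≤ totalVariation Ω u := by
  refine le_iSup_of_le ⟨0, by simp⟩ ?_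
  have : ((0 : 𝓓(Ω, Plane)) : Plane → Plane) = 0 := rfl
  simp [divergence, this]

theorem totalVariation_zero : totalVariation Ω 0 = 0 :=
  le_antisymm (totalVariation_le_iff (M := 0).2 fun k _ => (inner_zero_right k).le)
    (totalVariation_nonneg 0)

theorem mem_subdifferential_of_mem_supportFace {u p : L2 Ω}
    (hp : p ∈ supportFace (tvPolar Ω) u) : p ∈ subdifferential (totalVariation Ω) u := by
  intro v
  have h1 : totalVariation Ω u ≤ (inner ℝ p u : ℝ) := totalVariation_le_iff.2 hp.2
  have h2 : ((inner ℝ p v : ℝ) : EReal) ≤ totalVariation Ω v := by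
    have hv := totalVariation_nonneg v
    induction h : totalVariation Ω v with
    | bot => rw [h] at hv; simp at hv
    | top => exact le_top
    | coe M => exact_mod_cast totalVariation_le_iff.1 h.le p hp.1
  calc totalVariation Ω u + ((inner ℝ p (v - u) : ℝ) : EReal)
      ≤ (inner ℝ p u : ℝ) + ((inner ℝ p (v - u) : ℝ) : EReal) := by gcongr
    _ = (inner ℝ p v : ℝ) := by rw [← EReal.coe_add, ← inner_add_right, add_sub_cancel]
    _ ≤ _ := h2

/-- Comparison with v = 0 excludes +∞; monotonicity needs this finiteness to cancel the values of
the functional. -/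
theorem exists_totalVariation_eq_coe {u p : L2 Ω}
    (hp : p ∈ subdifferential (totalVariation Ω) u) : ∃ r : ℝ, totalVariation Ω u = r := by
  have h0 := hp 0
  have h1 := totalVariation_nonneg u
  rw [totalVariation_zero] at h0
  induction h : totalVariation Ω u with
  | bot => rw [h] at h1; simp at h1
  | top => rw [h] at h0; simp at h0
  | coe r => exact ⟨r, rfl⟩

theorem subdifferential_totalVariation_monotone {u v p q : L2 Ω}
    (hp : p ∈ subdifferential (totalVariation Ω) u)
    (hq : q ∈ subdifferential (totalVariation Ω) v) : 0 ≤ inner ℝ (p - q) (u - v) := by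
  obtain ⟨a, ha⟩ := exists_totalVariation_eq_coe hp
  obtain ⟨b, hb⟩ := exists_totalVariation_eq_coe hq
  have h1 := hp v
  have h2 := hq u
  rw [ha, hb, ← EReal.coe_add, EReal.coe_le_coe_iff] at h1 h2
  simp only [inner_sub_left, inner_sub_right] at h1 h2 ⊢
  linarith

/-- Integration by parts bounds the pairing by ∫ |∇g|, uniformly over admissible fields. -/
theorem toLp_mem_boundedOn_tvPolar {g : Plane → ℝ} (hg : ContDiff ℝ 1 g)
    (hgc : HasCompactSupport g) :
    (memLp_of_continuous_hasCompactSupport (Ω := Ω) hg.continuous hgc).toLp g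
      ∈ boundedOn (tvPolar Ω) := by
  have hmem := memLp_of_continuous_hasCompactSupport (Ω := Ω) hg.continuous hgc
  have hgrad : Continuous (gradient g) :=
    (InnerProductSpace.toDual ℝ Plane).symm.continuous.comp (hg.continuous_fderiv one_ne_zero)
  have hgradc : HasCompactSupport (gradient g) :=
    (hgc.fderiv (𝕜 := ℝ)).mono' fun x hx => subset_tsupport _ fun h => hx (by simp [gradient, h])
  refine ⟨∫ x in (Ω : Set Plane), ‖gradient g x‖, fun k hk => ?_⟩
  have hcl : IsClosed {k : L2 Ω | |inner ℝ k (hmem.toLp g)|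
      ≤ ∫ x in (Ω : Set Plane), ‖gradient g x‖} :=
    isClosed_le (continuous_id.inner continuous_const).abs continuous_const
  refine closure_minimal ?_ hcl hk
  rintro _ ⟨φ, hφ, rfl⟩
  have e : inner ℝ (divL2 φ) (hmem.toLp g) = ∫ x in (Ω : Set Plane), divergence φ x * g x := by
    rw [divL2, real_inner_comm, inner_toLp_left]
    refine integral_congr_ae ?_
    filter_upwards [(memLp_divergence φ).coeFn_toLp] with x hx
    rw [hx]
  rw [mem_ofPred_eq, e, setIntegral_divergence_mul φ hg, abs_neg, ← Real.norm_eq_abs]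
  refine norm_integral_le_of_norm_le
    (hgrad.integrable_of_hasCompactSupport hgradc).norm.restrict (ae_of_all _ fun x => ?_)
  refine (norm_inner_le_norm _ _).trans ?_
  exact mul_le_of_le_one_left (norm_nonneg _) (hφ x)

/-- A vector orthogonal to this subspace is orthogonal to all test functions, hence zero by the
fundamental lemma of the calculus of variations. -/
theorem dense_boundedOn_tvPolar [IsFiniteMeasure (volume.restrict (Ω : Set Plane))] :
    Dense (boundedOn (tvPolar Ω) : Set (L2 Ω)) := by
  rw [Submodule.dense_iff_topologicalClosure_eq_top, Submodule.topologicalClosure_eq_top_iff,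
    Submodule.eq_bot_iff]
  intro u hu
  have hint : IntegrableOn u (Ω : Set Plane) := (Lp.memLp u).integrable one_le_two
  have key := Ω.isOpen.ae_eq_zero_of_integral_contDiff_smul_eq_zero
    (hint.locallyIntegrableOn) (fun g hg hgc hgs => by
      have hg1 : ContDiff ℝ 1 g := hg.of_le (by simp)
      have h1 := hu _ (toLp_mem_boundedOn_tvPolar (Ω := Ω) hg1 hgc)
      rw [inner_toLp_left] at h1
      rw [← setIntegral_eq_integral_of_forall_compl_eq_zero (s := (Ω : Set Plane)), ← h1]
      · simp only [smul_eq_mul, mul_comm]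
      · intro x hx
        rw [image_eq_zero_of_notMem_tsupport fun h => hx (hgs h), zero_smul])
  refine Lp.ext ?_
  filter_upwards [ae_restrict_of_ae key, ae_restrict_mem Ω.isOpen.measurableSet,
    Lp.coeFn_zero ℝ 2 (volume.restrict (Ω : Set Plane))] with x h1 h2 h3
  rw [h3, h1 h2]
  rfl

end Divergence

/-! ### The Neumann flux -/

section Flux

open Filter Topology

theorem isClosed_setOf_ae_norm_le {α E : Type*} [MeasurableSpace α] {μ : Measure α}
    [NormedAddCommGroup E] (C : ℝ) : IsClosed {f : Lp E 2 μ | ∀ᵐ x ∂μ, ‖f x‖ ≤ C} := by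
  refine isSeqClosed_iff_isClosed.1 fun f g hf hg => ?_
  obtain ⟨ns, -, hns⟩ := (tendstoInMeasure_of_tendsto_Lp hg).exists_seq_tendsto_ae
  filter_upwards [hns, ae_all_iff.2 hf] with x h1 h2
  exact le_of_tendsto h1.norm (Eventually.of_forall fun n => h2 _)

theorem convex_setOf_ae_norm_le {α E : Type*} [MeasurableSpace α] {μ : Measure α}
    [NormedAddCommGroup E] [NormedSpace ℝ E] (C : ℝ) :
    Convex ℝ {f : Lp E 2 μ | ∀ᵐ x ∂μ, ‖f x‖ ≤ C} := by
  intro f hf g hg a b ha hb hab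
  filter_upwards [hf, hg, Lp.coeFn_add (a • f) (b • g), Lp.coeFn_smul a f, Lp.coeFn_smul b g]
    with x h1 h2 h3 h4 h5
  rw [h3, Pi.add_apply, h4, h5]
  have := (convex_closedBall (0 : E) C) (mem_closedBall_zero_iff.2 h1)
    (mem_closedBall_zero_iff.2 h2) ha hb hab
  simpa using this

theorem ae_norm_le_of_tendsto_inner {α E : Type*} [MeasurableSpace α] {μ : Measure α}
    [NormedAddCommGroup E] [InnerProductSpace ℝ E] [CompleteSpace E] {ι : Type*} {l : Filter ι}
    [l.NeBot] {Z : ι → Lp E 2 μ} {z : Lp E 2 μ} {C : ℝ} (hZ : ∀ i, ∀ᵐ x ∂μ, ‖Z i x‖ ≤ C)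
    (hz : ∀ y, Tendsto (fun i => inner ℝ (Z i) y) l (𝓝 (inner ℝ z y))) : ∀ᵐ x ∂μ, ‖z x‖ ≤ C := by
  have h1 := isClosed_setOf_ae_norm_le (E := E) (μ := μ) C
  have h2 := convex_setOf_ae_norm_le (E := E) (μ := μ) C
  have h3 : ∀ᶠ i in l, Z i ∈ {f : Lp E 2 μ | ∀ᵐ x ∂μ, ‖f x‖ ≤ C} := Eventually.of_forall hZ
  change z ∈ {f : Lp E 2 μ | ∀ᵐ x ∂μ, ‖f x‖ ≤ C}
  generalize {f : Lp E 2 μ | ∀ᵐ x ∂μ, ‖f x‖ ≤ C} = S at *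
  exact mem_of_tendsto_inner h1 h2 h3 hz

theorem exists_tendsto_inner_of_ae_norm_le {α E : Type*} [MeasurableSpace α] {μ : Measure α}
    [IsFiniteMeasure μ] [NormedAddCommGroup E] [InnerProductSpace ℝ E] [CompleteSpace E]
    {Z : ℕ → Lp E 2 μ} (hZ : ∀ n, ∀ᵐ x ∂μ, ‖Z n x‖ ≤ 1) :
    ∃ z : Lp E 2 μ, (∀ᵐ x ∂μ, ‖z x‖ ≤ 1) ∧
      ∀ y, Tendsto (fun n => inner ℝ (Z n) y) (hyperfilter ℕ : Filter ℕ) (𝓝 (inner ℝ z y)) := by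
  obtain ⟨C, hC⟩ : ∃ C, ∀ n, ‖Z n‖ ≤ C := ⟨_, fun n => Lp.norm_le_of_ae_bound zero_le_one (hZ n)⟩
  obtain ⟨z, -, hz⟩ := exists_tendsto_inner_of_norm_le (hyperfilter ℕ) (Eventually.of_forall hC)
  exact ⟨z, ae_norm_le_of_tendsto_inner hZ hz, hz⟩

theorem inner_toLp_right {α E : Type*} [MeasurableSpace α] {μ : Measure α} [NormedAddCommGroup E]
    [InnerProductSpace ℝ E] (f : Lp E 2 μ) {g : α → E} (hg : MemLp g 2 μ) :
    inner ℝ f (hg.toLp g) = ∫ x, inner ℝ (f x) (g x) ∂μ := by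
  rw [L2.inner_def]
  refine integral_congr_ae ?_
  filter_upwards [hg.coeFn_toLp] with x hx
  rw [hx]

theorem memLp_gradient {Ω : Opens Plane} {w : Plane → ℝ} (hw : ContDiff ℝ 1 w)
    (hwc : HasCompactSupport w) : MemLp (gradient w) 2 (volume.restrict (Ω : Set Plane)) :=
  memLp_of_continuous_hasCompactSupport
    ((InnerProductSpace.toDual ℝ Plane).symm.continuous.comp (hw.continuous_fderiv one_ne_zero))
    ((hwc.fderiv (𝕜 := ℝ)).mono' fun x hx => subset_tsupport _ fun h => hx (by simp [gradient, h]))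

theorem memLp_neg_testFunction {Ω : Opens Plane} (φ : 𝓓(Ω, Plane)) :
    MemLp (fun x => -φ x) 2 (volume.restrict (Ω : Set Plane)) :=
  (memLp_of_continuous_hasCompactSupport φ.continuous φ.hasCompactSupport).neg

theorem inner_neg_toLp_gradient {Ω : Opens Plane} (φ : 𝓓(Ω, Plane)) {w : Plane → ℝ}
    (hw : ContDiff ℝ 1 w) (hG : MemLp (gradient w) 2 (volume.restrict (Ω : Set Plane)))
    (hW : MemLp w 2 (volume.restrict (Ω : Set Plane))) :
    inner ℝ ((memLp_neg_testFunction φ).toLp _) (hG.toLp _) = inner ℝ (divL2 φ) (hW.toLp _) := by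
  rw [inner_toLp_right, real_inner_comm, inner_toLp_left]
  calc _ = -∫ x in (Ω : Set Plane), inner ℝ (φ x) (gradient w x) := by
        rw [← integral_neg]
        refine integral_congr_ae ?_
        filter_upwards [(memLp_neg_testFunction φ).coeFn_toLp] with x hx
        rw [hx, inner_neg_left]
    _ = ∫ x in (Ω : Set Plane), divergence φ x * w x := (setIntegral_divergence_mul φ hw).symm
    _ = _ := by
        refine integral_congr_ae ?_
        filter_upwards [(memLp_divergence φ).coeFn_toLp] with x hx
        rw [divL2, hx]

/-- If div φₙ → p in L², z is a weak limit of -φₙ. Each φₙ has compact support in Ω, so integration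
by parts has no boundary term even when w does not vanish on ∂Ω; the bound |z| ≤ 1 is a closed
convex constraint. -/
theorem hasNeumannFlux_of_mem_tvPolar {Ω : Opens Plane}
    [IsFiniteMeasure (volume.restrict (Ω : Set Plane))] {p : L2 Ω} (hp : p ∈ tvPolar Ω) :
    HasNeumannFlux Ω p := by
  obtain ⟨k, hk, hkp⟩ := mem_closure_iff_seq_limit.1 hp
  choose φ hφ hφk using hk
  obtain ⟨z, hz1, hz⟩ := exists_tendsto_inner_of_ae_norm_le
    (Z := fun n => (memLp_neg_testFunction (φ n)).toLp _) fun n => by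
      filter_upwards [(memLp_neg_testFunction (φ n)).coeFn_toLp] with x hx
      rw [hx, norm_neg]
      exact hφ n x
  refine ⟨z, Lp.aestronglyMeasurable z, hz1, fun w => ?_⟩
  have hw : ContDiff ℝ 1 w := w.contDiff.of_le (by simp)
  have hG := memLp_gradient (Ω := Ω) hw w.hasCompactSupport
  have hW : MemLp w 2 (volume.restrict (Ω : Set Plane)) :=
    memLp_of_continuous_hasCompactSupport w.continuous w.hasCompactSupport
  have h1 : Tendsto (fun n => inner ℝ (k n) (hW.toLp _)) (hyperfilter ℕ : Filter ℕ)
      (𝓝 (inner ℝ p (hW.toLp _))) :=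
    (hkp.inner tendsto_const_nhds).mono_left Nat.hyperfilter_le_atTop
  have h2 : inner ℝ z (hG.toLp _) = inner ℝ p (hW.toLp _) := by
    refine tendsto_nhds_unique (hz (hG.toLp _)) (h1.congr fun n => ?_)
    rw [← hφk n, inner_neg_toLp_gradient (φ n) hw hG hW]
  rw [← inner_toLp_right z hG, h2, real_inner_comm, inner_toLp_left]

end Flux

/-! ### Monotonicity from the sign of the derivative -/

section AbsolutelyContinuous

theorem _root_.AbsolutelyContinuousOnInterval.norm {E : Type*} [NormedAddCommGroup E] {f : ℝ → E}
    {a b : ℝ} (hf : AbsolutelyContinuousOnInterval f a b) :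
    AbsolutelyContinuousOnInterval (fun t => ‖f t‖) a b := by
  rw [absolutelyContinuousOnInterval_iff] at hf ⊢
  intro ε hε
  obtain ⟨δ, hδ, h⟩ := hf ε hε
  refine ⟨δ, hδ, fun I hI hlt => (Finset.sum_le_sum fun i _ => ?_).trans_lt (h I hI hlt)⟩
  rw [Real.dist_eq, dist_eq_norm]
  exact abs_norm_sub_norm_le _ _

theorem _root_.AbsolutelyContinuousOnInterval.le_of_ae_deriv_nonpos {f : ℝ → ℝ} {a b : ℝ}
    (hab : a ≤ b) (hf : AbsolutelyContinuousOnInterval f a b)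
    (h : ∀ᵐ t ∂(volume.restrict (Ioc a b)), deriv f t ≤ 0) : f b ≤ f a := by
  have h1 := hf.integral_deriv_eq_sub
  rw [intervalIntegral.integral_of_le hab] at h1
  have := integral_nonpos_of_ae h
  linarith

end AbsolutelyContinuous

/-! ### Uniqueness, existence and the Lipschitz bound -/

section Main

variable {Ω : Opens Plane}

/-- The derivative of ‖u - v‖² is -2⟪p - q, u - v⟫ ≤ 0 almost everywhere. Absolute continuity holds
only away from time 0, so the comparison starts at s > 0 and s → 0 by continuity. -/
theorem IsTVFlow.norm_sub_le {u₀ v₀ : L2 Ω} {u v : ℝ → L2 Ω} (hu : IsTVFlow Ω u₀ u)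
    (hv : IsTVFlow Ω v₀ v) {t : ℝ} (ht : 0 ≤ t) : ‖u t - v t‖ ≤ ‖u₀ - v₀‖ := by
  rcases ht.eq_or_lt with rfl | ht
  · rw [hu.initial, hv.initial]
  have key : ∀ s, 0 < s → s < t → ‖u t - v t‖ ≤ ‖u s - v s‖ := by
    intro s hs hst
    have hac := ((hu.absolutelyContinuous s t hs hst.le).sub
      (hv.absolutelyContinuous s t hs hst.le)).norm
    have hle := (hac.fun_mul hac).le_of_ae_deriv_nonpos hst.le (by
      filter_upwards [ae_restrict_of_ae_restrict_of_subset
          (fun r hr => hs.trans hr.1 : Ioc s t ⊆ Ioi 0) hu.flow,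
        ae_restrict_of_ae_restrict_of_subset
          (fun r hr => hs.trans hr.1 : Ioc s t ⊆ Ioi 0) hv.flow] with r h1 h2
      obtain ⟨p, hp, -, hp'⟩ := h1
      obtain ⟨q, hq, -, hq'⟩ := h2
      have hd := (hp'.sub hq').norm_sq
      have e : (fun r => ‖(u - v) r‖ * ‖(u - v) r‖) = fun r => ‖(u - v) r‖ ^ 2 := by
        funext r; ring
      rw [e, hd.deriv]
      have := subdifferential_totalVariation_monotone hp hq
      rw [real_inner_comm] at this
      have e2 : -p - -q = -(p - q) := by abel
      rw [e2, inner_neg_right]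
      change 2 * -inner ℝ (u r - v r) (p - q) ≤ 0
      linarith)
    exact le_of_sq_le_sq (by rw [sq, sq]; exact hle) (norm_nonneg _)
  have hlim : Filter.Tendsto (fun s => ‖u s - v s‖) (nhdsWithin 0 (Ioi 0)) (nhds ‖u 0 - v 0‖) :=
    (((hu.continuousOn.sub hv.continuousOn).norm 0 self_mem_Ici).mono_left
      (nhdsWithin_mono _ Ioi_subset_Ici_self))
  rw [hu.initial, hv.initial] at hlim
  refine ge_of_tendsto hlim ?_
  filter_upwards [Ioo_mem_nhdsGT ht] with s hs
  exact key s hs.1 hs.2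

theorem IsTVFlow.eqOn {u₀ : L2 Ω} {u v : ℝ → L2 Ω} (hu : IsTVFlow Ω u₀ u)
    (hv : IsTVFlow Ω u₀ v) : EqOn u v (Ici 0) := fun t ht => by
  have := hu.norm_sub_le hv ht
  rw [sub_self, norm_zero] at this
  exact sub_eq_zero.1 (norm_le_zero_iff.1 this)

variable [IsFiniteMeasure (volume.restrict (Ω : Set Plane))]

theorem dense_supportFace_tvPolar_nonempty :
    Dense {x | (supportFace (tvPolar Ω) x).Nonempty} :=
  isFlowGenerator_tvPolar.dense_supportFace_nonempty dense_boundedOn_tvPolar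

theorem isTVFlow_flow (u₀ : L2 Ω) : IsTVFlow Ω u₀ fun t => flow (tvPolar Ω) t u₀ := by
  have hK := isFlowGenerator_tvPolar (Ω := Ω)
  have hd := dense_supportFace_tvPolar_nonempty (Ω := Ω)
  refine ⟨hK.continuousOn_flow hd u₀, hK.flow_zero hd u₀, fun a b ha hab => ?_, ?_⟩
  · refine LipschitzOnWith.absolutelyContinuousOnInterval (K := (‖u₀‖ / a).toNNReal) ?_
    rw [uIcc_of_le hab]
    have aux : ∀ s ∈ Icc a b, ∀ t ∈ Icc a b, s ≤ t →
        dist (flow (tvPolar Ω) s u₀) (flow (tvPolar Ω) t u₀) ≤ ‖u₀‖ / a * dist s t := by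
      intro s hs t ht hst
      have h0 := ha.trans_le hs.1
      have h1 := sub_nonneg.2 hst
      rw [dist_comm, dist_comm s, dist_eq_norm, dist_eq_norm, Real.norm_of_nonneg h1]
      refine (hK.norm_flow_sub_flow_le_div hd h0 hst u₀).trans ?_
      gcongr
      exact hs.1
    refine LipschitzOnWith.of_dist_le_mul fun s hs t ht => ?_
    rw [Real.coe_toNNReal _ (by positivity)]
    rcases le_total s t with h | h
    · exact aux s hs t ht h
    · rw [dist_comm, dist_comm s]
      exact aux t ht s hs h
  · obtain ⟨S, hS, h⟩ := hK.exists_countable_hasDerivAt_flow hd u₀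
    filter_upwards [ae_restrict_mem measurableSet_Ioi, ae_restrict_of_ae (hS.ae_notMem volume)]
      with t ht htS
    obtain ⟨p, hp, hp'⟩ := h t ht htS
    exact ⟨p, mem_subdifferential_of_mem_supportFace hp, hasNeumannFlux_of_mem_tvPolar hp.1, hp'⟩

theorem IsTVFlow.norm_sub_le_div {u₀ : L2 Ω} {u : ℝ → L2 Ω} (hu : IsTVFlow Ω u₀ u)
    {δ s t : ℝ} (hδ : 0 < δ) (hs : δ ≤ s) (ht : δ ≤ t) : ‖u t - u s‖ ≤ ‖u₀‖ / δ * |t - s| := by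
  have aux : ∀ {s t : ℝ}, δ ≤ s → s ≤ t → ‖u t - u s‖ ≤ ‖u₀‖ / δ * |t - s| := by
    intro s t hs hst
    have hs0 := hδ.trans_le hs
    rw [hu.eqOn (isTVFlow_flow u₀) hs0.le, hu.eqOn (isTVFlow_flow u₀) (hs0.le.trans hst),
      abs_of_nonneg (sub_nonneg.2 hst)]
    refine (isFlowGenerator_tvPolar.norm_flow_sub_flow_le_div dense_supportFace_tvPolar_nonempty
      hs0 hst u₀).trans ?_
    have := sub_nonneg.2 hst
    gcongr
  rcases le_total s t with h | h
  · exact aux hs h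
  · rw [norm_sub_rev, abs_sub_comm]
    exact aux ht h

/-- Triangle inequality through w τ: contraction in the datum, then the smoothing bound along w on
times at least t - ε. -/
theorem IsTVFlow.norm_sub_le_max {v₀ w₀ : L2 Ω} {v w : ℝ → L2 Ω} (hv : IsTVFlow Ω v₀ v)
    (hw : IsTVFlow Ω w₀ w) {u₀ : L2 Ω} {t ε τ σ : ℝ} (hεt : ε < t) (hτ : |τ - t| < ε)
    (hw₀ : ‖w₀ - u₀‖ < ε) (hσ : |σ - t| < ε) :
    ‖v τ - w σ‖ ≤ max ((‖u₀‖ + ε) / (t - ε)) 1 * (‖v₀ - w₀‖ + |τ - σ|) := by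
  have hδ : 0 < t - ε := sub_pos.2 hεt
  have hτ' : t - ε ≤ τ := by linarith [(abs_lt.1 hτ).1]
  have hσ' : t - ε ≤ σ := by linarith [(abs_lt.1 hσ).1]
  have h1 := hv.norm_sub_le hw (hδ.le.trans hτ')
  have h2 := hw.norm_sub_le_div hδ hσ' hτ'
  have h3 : ‖w₀‖ ≤ ‖u₀‖ + ε := by linarith [norm_sub_norm_le w₀ u₀]
  have h4 := norm_sub_le_norm_sub_add_norm_sub (v τ) (w τ) (w σ)
  set M := max ((‖u₀‖ + ε) / (t - ε)) 1
  have h5 : ‖w₀‖ / (t - ε) ≤ M := le_trans (by gcongr) (le_max_left _ _)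
  have h6 : ‖v₀ - w₀‖ ≤ M * ‖v₀ - w₀‖ :=
    le_mul_of_one_le_left (norm_nonneg _) (le_max_right _ _)
  have h7 : ‖w₀‖ / (t - ε) * |τ - σ| ≤ M * |τ - σ| := by gcongr
  rw [mul_add]
  linarith

end Main

end TVFlow

theorem mainTheorem1 (Ω : Opens TVFlow.Plane)
    (hbdd : Bornology.IsBounded (Ω : Set TVFlow.Plane))
    (hlip : TVFlow.HasLipschitzBoundary (Ω : Set TVFlow.Plane)) :
    -- the solution operator is well defined
    (∀ u₀ : TVFlow.L2 Ω, ∃ u : ℝ → TVFlow.L2 Ω, TVFlow.IsTVFlow Ω u₀ u ∧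
      ∀ v : ℝ → TVFlow.L2 Ω, TVFlow.IsTVFlow Ω u₀ v → EqOn v u (Ici 0)) ∧
    ∀ ψ : TVFlow.L2 Ω → ℝ → TVFlow.L2 Ω, (∀ u₀, TVFlow.IsTVFlow Ω u₀ (ψ u₀)) →
      -- it is locally Lipschitz on `L²(Ω) × (0, ∞)` for the norm `‖u₀‖ + |t|`
      LocallyLipschitzOn {q : WithLp 1 (TVFlow.L2 Ω × ℝ) | 0 < q.snd}
        (fun q => ψ q.fst q.snd) ∧
      -- with an explicit constant on `ε`-neighbourhoods
      ∀ (u₀ : TVFlow.L2 Ω) (t ε : ℝ), 0 < ε → ε < t →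
        ∀ (v w : TVFlow.L2 Ω) (τ σ : ℝ), ‖v - u₀‖ < ε → |τ - t| < ε → ‖w - u₀‖ < ε → |σ - t| < ε →
          ‖ψ v τ - ψ w σ‖ ≤ max ((‖u₀‖ + ε) / (t - ε)) 1 * (‖v - w‖ + |τ - σ|) := by
  have : IsFiniteMeasure (volume.restrict (Ω : Set TVFlow.Plane)) :=
    isFiniteMeasure_restrict.2 hbdd.measure_lt_top.ne
  refine ⟨fun u₀ => ⟨_, TVFlow.isTVFlow_flow u₀, fun v hv => hv.eqOn (TVFlow.isTVFlow_flow u₀)⟩,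
    fun ψ hψ => ⟨?_, fun u₀ t ε _ hεt v w τ σ _ hτ hw hσ =>
      (hψ v).norm_sub_le_max (hψ w) hεt hτ hw hσ⟩⟩
  intro q₀ hq₀
  have ht : 0 < q₀.snd := hq₀
  -- The explicit constant with ε = t / 2, which keeps the neighbourhood away from time 0.
  set M := max ((‖q₀.fst‖ + q₀.snd / 2) / (q₀.snd - q₀.snd / 2)) 1
  have hM : 0 ≤ M := zero_le_one.trans (le_max_right _ _)
  refine ⟨M.toNNReal, Metric.ball q₀ (q₀.snd / 2) ∩ {q | 0 < q.snd},
    Filter.inter_mem (mem_nhdsWithin_of_mem_nhds (Metric.ball_mem_nhds _ (half_pos ht)))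
      self_mem_nhdsWithin, LipschitzOnWith.of_dist_le_mul fun q hq r hr => ?_⟩
  have hq1 := hq.1
  have hr1 := hr.1
  rw [Metric.mem_ball, WithLp.prod_dist_eq_of_L1, dist_eq_norm, Real.dist_eq] at hq1 hr1
  rw [Real.coe_toNNReal _ hM, WithLp.prod_dist_eq_of_L1, dist_eq_norm, dist_eq_norm, Real.dist_eq]
  exact (hψ _).norm_sub_le_max (hψ _) (half_lt_self ht)
    (by linarith [norm_nonneg (q.fst - q₀.fst)]) (by linarith [abs_nonneg (r.snd - q₀.snd)])
    (by linarith [norm_nonneg (r.fst - q₀.fst)])
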